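/- Let $n,d\ge 1$ be integers, let $\mathcal A=\mathbb Z[v^{\pm1},t^{\pm1}]$, and let $q$ be an odd prime power. Let $\mathscr X$ be the set of $n$-step flags $V=(0=V_0\subseteq V_1\subseteq\dots\subseteq V_n=\mathbb F_q^d)$, on which $G=GL_d(\mathbb F_q)$ acts; write $|W|$ for the dimension of a space $W$. The $G$-orbits $\mathcal O_M$ on $\mathscr X\times\mathscr X$ correspond to the $n\times n$ matrices $M$ over $\mathbb N$ with sum of entries $d$, where the $(i,j)$ entry of the matrix of $(V,V')$ is $\dim\frac{V_{i-1}+V_i\cap V'_j}{V_{i-1}+V_i\cap V'_{j-1}}$. Let $\mathcal S$ be the $\mathcal A$-module of $\mathcal A$-valued $G$-invariant functions on $\mathscr X\times\mathscr X$ (the functions constant on each $\mathcal O_M$), with the generic convolution product, that is, the $\mathcal A$-bilinear product on functions of $M$ which for every odd prime power $q$ specialises under $v\mapsto\sqrt q$ to $$(f*g)(V,V')=\sum_{V''\in\mathscr X}f(V,V'')\,g(V'',V').$$ Then $\mathcal S$ is closed under this product, so that it is an $\mathcal A$-algebra. For $i\in[1,n-1]$, $a\in[1,n]$ and a fixed sign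 $\varepsilon\in\{1,-1\}$ define functions, with value $0$ at all pairs $(V,V')$ not mentioned, by $$E_i(V,V')=v^{-|V'_i/V'_{i-1}|}t^{\varepsilon|V_i/V_{i-1}|}\ \text{ if } V_i\supset V'_i,\ |V_i/V'_i|=1,\ V_j=V'_j\ (j\ne i),$$ $$F_i(V,V')=v^{-|V'_{i+1}/V'_i|}t^{|V'_{i+1}/V'_i|}\ \text{ if } V_i\subset V'_i,\ |V'_i/V_i|=1,\ V_j=V'_j\ (j\ne i),$$ $$A_a^{\pm1}(V,V)=v^{\pm|V_a/V_{a-1}|}t^{\pm|V_a/V_{a-1}|},\qquad B_a^{\pm1}(V,V)=v^{\mp|V_a/V_{a-1}|}t^{\pm|V_a/V_{a-1}|}.$$ For either choice of $\varepsilon$, all these functions lie in $\mathcal S$, and the $\mathbb Q(v,t)$-algebra $\mathbb Q(v,t)\otimes_{\mathcal A}\mathcal S$ is generated by $E_i$, $F_i$ $(1\le i\le n-1)$ and $A_a^{\pm1}$, $B_a^{\pm1}$ $(1\le a\le n)$. -/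

import Mathlib

open scoped TensorProduct

noncomputable section

namespace TwoParamSchur

/-! ### Coefficients -/

/-- The ring `𝒜 = ℤ[v, v⁻¹, t, t⁻¹]`: Laurent polynomials in `t` over Laurent polynomials in `v`. -/
abbrev LaurentRing : Type := LaurentPolynomial (LaurentPolynomial ℤ)

/-- The field `ℚ(v, t)`, as the fraction field of `ℤ[v, v⁻¹, t, t⁻¹]`. -/
abbrev RatField : Type := FractionRing LaurentRing

/-- The monomial `v ^ a * t ^ b`, for integers `a` and `b`. -/
def mono (a b : ℤ) : LaurentRing :=
  LaurentPolynomial.C (LaurentPolynomial.T a) * LaurentPolynomial.T b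

/-- An odd prime power `q = p ^ k`, recorded by `p` and `k`. -/
structure OddPrimePower where
  p : ℕ
  k : ℕ
  prime : p.Prime
  odd : p ≠ 2
  pos : k ≠ 0

namespace OddPrimePower

/-- The number `q = p ^ k`. -/
def card (q : OddPrimePower) : ℕ := q.p ^ q.k

instance (q : OddPrimePower) : Fact q.p.Prime := ⟨q.prime⟩

/-- The finite field with `q` elements. -/
abbrev K (q : OddPrimePower) : Type := GaloisField q.p q.k

/-- The square root of `q`, a unit of `ℝ`. -/
def sqrtUnit (q : OddPrimePower) : ℝˣ :=
  Units.mk0 (Real.sqrt (q.card : ℝ))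
    (Real.sqrt_ne_zero'.mpr (by exact_mod_cast pow_pos q.prime.pos q.k))

end OddPrimePower

/-- The specialised coefficient ring `ℝ[t, t⁻¹]`; it is an `𝒜`-algebra (below) through
`v ↦ √q`, `t ↦ t`, which is why `q` is part of the type. -/
def Coeff (_q : OddPrimePower) : Type := LaurentPolynomial ℝ

instance (q : OddPrimePower) : CommRing (Coeff q) :=
  inferInstanceAs (CommRing (LaurentPolynomial ℝ))

/-- The ring homomorphism `ℤ[v, v⁻¹, t, t⁻¹] → ℝ[t, t⁻¹]` with `v ↦ √q` and `t ↦ t`. -/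
def specialize (q : OddPrimePower) : LaurentRing →+* Coeff q :=
  (LaurentPolynomial.eval₂
      (LaurentPolynomial.C.comp (LaurentPolynomial.eval₂ (Int.castRingHom ℝ) q.sqrtUnit))
      (LaurentPolynomial.isUnit_T 1).unit :
    LaurentRing →+* LaurentPolynomial ℝ)

instance (q : OddPrimePower) : Algebra LaurentRing (Coeff q) := (specialize q).toAlgebra

/-! ### Flags -/

section Flags

variable (n d : ℕ) (F : Type) [Field F]

/-- The `n`-step flags `0 = V₀ ⊆ V₁ ⊆ ⋯ ⊆ Vₙ = F ^ d`. -/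
@[ext]
structure StepFlag where
  sub : Fin (n + 1) → Submodule F (Fin d → F)
  mono : Monotone sub
  zero : sub 0 = ⊥
  last : sub (Fin.last n) = ⊤

variable {n d F}

instance [Finite F] : Finite (StepFlag n d F) :=
  Finite.of_injective StepFlag.sub fun _ _ h => StepFlag.ext h

instance [Finite F] : Fintype (StepFlag n d F) := Fintype.ofFinite _

instance : DecidableEq (StepFlag n d F) := Classical.decEq _

namespace StepFlag

/-- The action of `g ∈ GL(F ^ d)` on flags. -/
def act (g : (Fin d → F) ≃ₗ[F] (Fin d → F)) (V : StepFlag n d F) : StepFlag n d F where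
  sub i := (V.sub i).map (g : (Fin d → F) →ₗ[F] (Fin d → F))
  mono _ _ h := Submodule.map_mono (V.mono h)
  zero := by rw [V.zero, Submodule.map_bot]
  last := by rw [V.last, Submodule.map_top, LinearEquiv.range]

/-- For `a : Fin n`, standing for the index `a + 1 ∈ [1, n]`, the dimension of
`V_{a+1} / V_a`. -/
def layer (V : StepFlag n d F) (a : Fin n) : ℕ :=
  Module.finrank F (V.sub a.succ) - Module.finrank F (V.sub a.castSucc)

/-- The matrix of the pair `(V, V')`. In the indexing by `[1, n]` its `(i, j)` entry is
`dim (V_{i-1} + V_i ∩ V'_j) / (V_{i-1} + V_i ∩ V'_{j-1})`. Two pairs of flags are in the same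
`GL(F ^ d)`-orbit exactly when they have the same matrix, and the matrices that occur are the
`n × n` matrices over `ℕ` with sum of entries `d`. -/
def relPos (V V' : StepFlag n d F) : Matrix (Fin n) (Fin n) ℕ := fun i j =>
  Module.finrank F ↥(V.sub i.castSucc ⊔ V.sub i.succ ⊓ V'.sub j.succ) -
    Module.finrank F ↥(V.sub i.castSucc ⊔ V.sub i.succ ⊓ V'.sub j.castSucc)

/-- `V_i ⊃ V'_i` of codimension one and `V_j = V'_j` for all `j ≠ i`. -/
def CoversAt (i : Fin (n + 1)) (V V' : StepFlag n d F) : Prop :=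
  V'.sub i ≤ V.sub i ∧ Module.finrank F (V.sub i) = Module.finrank F (V'.sub i) + 1 ∧
    ∀ j, j ≠ i → V.sub j = V'.sub j

end StepFlag

end Flags

/-! ### The generic convolution algebra -/

/-- Families, indexed by the odd prime powers `q`, of functions on pairs of `n`-step flags in
`𝔽_q ^ d`, with values in `ℝ[t, t⁻¹]`. The product of matrices is the convolution
`(f * g) (V, V') = ∑ V'', f (V, V'') * g (V'', V')`. The scalar `v` acts as `√q` at `q`. -/
abbrev Families (n d : ℕ) : Type :=
  ∀ q : OddPrimePower, Matrix (StepFlag n d q.K) (StepFlag n d q.K) (Coeff q)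

/-- The `𝒜`-valued `GL_d`-invariant functions on pairs of flags: a function gives an element
`c M` of `𝒜` to the orbit with matrix `M`; it is recorded through its specialisations at
`v = √q` for all odd prime powers `q`. -/
def invariantFunctions (n d : ℕ) : Submodule LaurentRing (Families n d) where
  carrier := {f |
    (∀ (q : OddPrimePower) (g : (Fin d → q.K) ≃ₗ[q.K] (Fin d → q.K)) (V V' : StepFlag n d q.K),
      f q (V.act g) (V'.act g) = f q V V') ∧
    ∃ c : Matrix (Fin n) (Fin n) ℕ → LaurentRing,
      ∀ (q : OddPrimePower) (V V' : StepFlag n d q.K),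
        f q V V' = algebraMap LaurentRing (Coeff q) (c (V.relPos V'))}
  add_mem' := by
    rintro f f' ⟨hf, c, hc⟩ ⟨hf', c', hc'⟩
    refine ⟨fun q g V V' => ?_, c + c', fun q V V' => ?_⟩
    · simp [hf, hf']
    · simp [hc, hc']
  zero_mem' := ⟨fun _ _ _ _ => rfl, 0, fun _ _ _ => by simp⟩
  smul_mem' := by
    rintro a f ⟨hf, c, hc⟩
    refine ⟨fun q g V V' => ?_, fun M => a * c M, fun q V V' => ?_⟩
    · simp [hf]
    · simp [hc, Algebra.smul_def]

/-- The convolution algebra `𝒮` over `𝒜`: the algebra of the `𝒜`-valued invariant functions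
under convolution. -/
def schurAlgebra (n d : ℕ) : Subalgebra LaurentRing (Families n d) :=
  Algebra.adjoin LaurentRing (invariantFunctions n d : Set (Families n d))

/-! ### The generators -/

section Generators

variable {n d : ℕ}

open Classical in
/-- For `i + 1 < n`, the function `E` of index `i + 1 ∈ [1, n - 1]`, with sign `ε` in the exponent
of `t`. -/
def genE (ε : ℤˣ) (i : ℕ) (hi : i + 1 < n) : Families n d := fun q V V' =>
  let a : Fin n := ⟨i, by omega⟩
  if StepFlag.CoversAt a.succ V V' then
    algebraMap LaurentRing (Coeff q) (mono (-(V'.layer a : ℤ)) ((ε : ℤ) * (V.layer a : ℤ)))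
  else 0

open Classical in
/-- For `i + 1 < n`, the function `F` of index `i + 1 ∈ [1, n - 1]`. -/
def genF (i : ℕ) (hi : i + 1 < n) : Families n d := fun q V V' =>
  let a : Fin n := ⟨i, by omega⟩
  let b : Fin n := ⟨i + 1, hi⟩
  if StepFlag.CoversAt a.succ V' V then
    algebraMap LaurentRing (Coeff q) (mono (-(V'.layer b : ℤ)) (V'.layer b : ℤ))
  else 0

/-- For `a : Fin n`, standing for `a + 1 ∈ [1, n]`, and a sign `s`, the function `A ^ s`. -/
def genA (s : ℤˣ) (a : Fin n) : Families n d := fun q V V' =>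
  if V = V' then
    algebraMap LaurentRing (Coeff q)
      (mono ((s : ℤ) * (V'.layer a : ℤ)) ((s : ℤ) * (V'.layer a : ℤ)))
  else 0

/-- For `a : Fin n`, standing for `a + 1 ∈ [1, n]`, and a sign `s`, the function `B ^ s`. -/
def genB (s : ℤˣ) (a : Fin n) : Families n d := fun q V V' =>
  if V = V' then
    algebraMap LaurentRing (Coeff q)
      (mono (-((s : ℤ) * (V'.layer a : ℤ))) ((s : ℤ) * (V'.layer a : ℤ)))
  else 0

/-- The set of all functions `E_i`, `F_i`, `A_a^{±1}`, `B_a^{±1}`. -/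
def generators (n d : ℕ) (ε : ℤˣ) : Set (Families n d) :=
  {f | (∃ i, ∃ hi : i + 1 < n, f = genE ε i hi) ∨ (∃ i, ∃ hi : i + 1 < n, f = genF i hi) ∨
    (∃ s a, f = genA s a) ∨ (∃ s a, f = genB s a)}

end Generators

end TwoParamSchur

end

/-! Closure under convolution. The matrix of a pair of flags is the second difference of the table
of dimensions of `V_i ∩ V'_j`, and it determines that table. So invariant functions are functions of
the table (`mem_invariantFunctions_iff`), and the task is to sum over flags `V''` a weight depending
only on the dimensions of `V''_k ∩ V_i ∩ V'_j`, uniformly in `q`. Flags are summed as descending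
chains, one member at a time, which reduces the task to sums over the subspaces `U` of a given `H`
(`exists_sum_subspaces`). These are treated by induction on `dim H`. A hyperplane of `H`, cut out by
a functional `l` adapted to both flags, splits the `U` into those inside it and those of the form
`U' + ⟨x⟩` with `U'` inside it and `l x = 1`. Adding `x` changes the table of `U'` by a corner whose
position depends on the first `j` with `x ∈ U' + V'_j`. The number of `x` with a given position,
divided by the `q ^ dim U'` repetitions, is a difference of powers of `q` with exponents read off
from the tables, so it lifts to powers of `v ^ 2`.

Generation. Let `T` be the set of elements of the algebra whose images lie in the subalgebra
generated over `ℚ(v, t)`; nonzero scalars can be cancelled in it. The values of `A_a` are the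
distinct elements `(vt) ^ r`, so Lagrange interpolation puts every diagonal function in `T`
(`diagHom_mem`). Removing invertible diagonal factors from `E_i` and `F_i` leaves the indicator
functions of their supports; this makes the sign `ε` irrelevant.

Multiplying the characteristic function of the orbit of a matrix `A` by one of these indicators
gives orbits that differ from `A` by moving a unit between adjacent rows within one column. Give the
entry `(i, j)` the weight `(i - j) ^ 2`. For a non-diagonal `M`, move a unit of an extreme
off-diagonal column towards the diagonal. The resulting `A` is lighter than `M`, and so is every
other orbit in the product. Its coefficient at `M` is nonzero because it specialises to a positive
count, so induction on the weight reaches all orbits (`orbitFun_mem`). -/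

noncomputable section

namespace TwoParamSchur

/-! ### Subspaces cut by a hyperplane -/

section Hyperplane

variable {K E : Type*} [Field K] [AddCommGroup E] [Module K E]

lemma finrank_eq_finrank_inf_ker [FiniteDimensional K E] (l : E →ₗ[K] K) (A : Submodule K E)
    [Decidable (A ≤ LinearMap.ker l)] :
    Module.finrank K A = Module.finrank K ↥(A ⊓ LinearMap.ker l) +
      if A ≤ LinearMap.ker l then 0 else 1 := by
  have h := LinearMap.finrank_range_add_finrank_ker (l.domRestrict A)
  have hk : Module.finrank K (LinearMap.ker (l.domRestrict A)) =
      Module.finrank K ↥(A ⊓ LinearMap.ker l) := by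
    rw [LinearMap.ker_domRestrict, inf_comm, ← Submodule.finrank_map_subtype_eq A,
      Submodule.map_comap_subtype, inf_comm]
  rw [hk] at h
  split_ifs with hA
  · rw [inf_eq_left.2 hA, add_zero]
  · obtain ⟨x, hx, hlx⟩ := Set.not_subset.1 hA
    have : LinearMap.range (l.domRestrict A) = ⊤ := by
      apply LinearMap.range_eq_top.2
      apply LinearMap.surjective
      intro h0
      exact hlx (by simpa using LinearMap.congr_fun h0 ⟨x, hx⟩)
    rw [this, finrank_top, Module.finrank_self] at h
    omega

lemma sup_span_inf_ker (l : E →ₗ[K] K) {U : Submodule K E} (hU : U ≤ LinearMap.ker l) {x : E}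
    (hx : l x = 1) : (U ⊔ K ∙ x) ⊓ LinearMap.ker l = U := by
  apply le_antisymm
  · rintro y ⟨hy, hly⟩
    obtain ⟨u, hu, z, hz, rfl⟩ := Submodule.mem_sup.1 hy
    obtain ⟨c, rfl⟩ := Submodule.mem_span_singleton.1 hz
    have hc : c = 0 := by simpa [hx, LinearMap.mem_ker.1 (hU hu)] using hly
    simpa [hc] using hu
  · exact le_inf le_sup_left hU

lemma inf_ker_sup_span (l : E →ₗ[K] K) {U : Submodule K E} {x : E} (hxU : x ∈ U)
    (hx : l x = 1) : (U ⊓ LinearMap.ker l) ⊔ K ∙ x = U := by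
  apply le_antisymm
  · exact sup_le inf_le_left (by simpa using hxU)
  · intro y hy
    refine Submodule.mem_sup.2 ⟨y - l y • x, ⟨U.sub_mem hy (U.smul_mem _ hxU), ?_⟩, l y • x,
      Submodule.smul_mem _ _ (Submodule.mem_span_singleton_self x), by simp⟩
    simp [hx]

lemma card_filter_eq_one [Fintype K] [Fintype E] (l : E →ₗ[K] K) (U : Submodule K E)
    (hU : ¬ U ≤ LinearMap.ker l) [DecidablePred fun x => x ∈ U ∧ l x = 1] :
    (Finset.univ.filter fun x => x ∈ U ∧ l x = 1).card =
      Fintype.card K ^ Module.finrank K ↥(U ⊓ LinearMap.ker l) := by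
  classical
  obtain ⟨x, hx, hlx⟩ := Set.not_subset.1 hU
  have hlx : l x ≠ 0 := hlx
  set e := (l x)⁻¹ • x with he
  have heU : e ∈ U := U.smul_mem _ hx
  have hle : l e = 1 := by simp [he, hlx]
  rw [← Module.card_eq_pow_finrank (K := K) (V := ↥(U ⊓ LinearMap.ker l)),
    ← Finset.card_univ]
  refine Finset.card_bij' (fun y _ => if h : y - e ∈ U ⊓ LinearMap.ker l then ⟨y - e, h⟩ else 0)
    (fun y _ => y + e) ?_ ?_ ?_ ?_
  · intros; simp
  · rintro ⟨y, hy, hly⟩ -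
    have : l y = 0 := hly
    simp [U.add_mem hy heU, this, hle]
  · intro y hy
    obtain ⟨hyU, hly⟩ := (Finset.mem_filter.1 hy).2
    have : y - e ∈ U ⊓ LinearMap.ker l := ⟨U.sub_mem hyU heU, by simp [hly, hle]⟩
    simp [this]
  · rintro ⟨y, hy⟩ -
    have : y + e - e ∈ U ⊓ LinearMap.ker l := by simpa using hy
    simp only [this, dite_true]
    simp

open Classical in
/-- A sum over the subspaces of `H` not contained in the hyperplane `l = 0`, written through their
intersections `U` with the hyperplane and the vectors on which `l` is `1`. -/
lemma sum_not_le_ker [Fintype K] [Fintype E] [Fintype (Submodule K E)] {R : Type*} [CommRing R]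
    (c : ℕ → R) (hc : ∀ k, c k * (Fintype.card K : R) ^ k = 1) (l : E →ₗ[K] K)
    (H : Submodule K E) (G : Submodule K E → R) :
    ∑ U with U ≤ H ∧ ¬ U ≤ LinearMap.ker l, G U =
      ∑ U with U ≤ H ⊓ LinearMap.ker l, c (Module.finrank K U) *
        ∑ x with x ∈ H ∧ l x = 1, G (U ⊔ K ∙ x) := by
  -- The vectors of `U` on which `l` is `1` form a coset of `U ⊓ ker l`. Averaging `G U` over them
  -- makes the pairs `(U, x)` correspond to the pairs `(U ⊓ ker l, x)`.
  have h1 : ∀ U ∈ Finset.univ.filter (fun U : Submodule K E => U ≤ H ∧ ¬ U ≤ LinearMap.ker l),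
      G U = ∑ x with x ∈ U ∧ l x = 1, c (Module.finrank K ↥(U ⊓ LinearMap.ker l)) * G U := by
    intro U hU
    rw [Finset.sum_const, card_filter_eq_one l U (Finset.mem_filter.1 hU).2.2, nsmul_eq_mul,
      ← mul_assoc]
    push_cast
    rw [mul_comm (_ ^ _), hc, one_mul]
  rw [Finset.sum_congr rfl h1]
  simp_rw [Finset.mul_sum]
  rw [Finset.sum_sigma', Finset.sum_sigma']
  refine Finset.sum_bij' (fun p _ => ⟨p.1 ⊓ LinearMap.ker l, p.2⟩)
    (fun p _ => ⟨p.1 ⊔ K ∙ p.2, p.2⟩) ?_ ?_ ?_ ?_ ?_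
  · rintro ⟨U, x⟩ h
    simp only [Finset.mem_sigma, Finset.mem_filter, Finset.mem_univ, true_and] at h ⊢
    exact ⟨inf_le_inf_right _ h.1.1, h.1.1 h.2.1, h.2.2⟩
  · rintro ⟨U, x⟩ h
    simp only [Finset.mem_sigma, Finset.mem_filter, Finset.mem_univ, true_and] at h ⊢
    have hxm : x ∈ U ⊔ K ∙ x := Submodule.mem_sup_right (Submodule.mem_span_singleton_self x)
    refine ⟨⟨sup_le (h.1.trans inf_le_left) (by simpa using h.2.1), fun hle => ?_⟩, hxm, h.2.2⟩
    have := LinearMap.mem_ker.1 (hle hxm)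
    rw [h.2.2] at this
    exact one_ne_zero this
  · rintro ⟨U, x⟩ h
    simp only [Finset.mem_sigma, Finset.mem_filter, Finset.mem_univ, true_and] at h ⊢
    rw [inf_ker_sup_span l h.2.1 h.2.2]
  · rintro ⟨U, x⟩ h
    simp only [Finset.mem_sigma, Finset.mem_filter, Finset.mem_univ, true_and] at h ⊢
    rw [sup_span_inf_ker l (h.1.trans inf_le_right) h.2.2]
  · rintro ⟨U, x⟩ h
    simp only [Finset.mem_sigma, Finset.mem_filter, Finset.mem_univ, true_and] at h ⊢
    rw [inf_ker_sup_span l h.2.1 h.2.2]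

open Classical in
lemma sum_le_eq_add [Fintype (Submodule K E)] {R : Type*} [CommRing R]
    (l : E →ₗ[K] K) (H : Submodule K E) (G : Submodule K E → R) :
    ∑ U with U ≤ H, G U = ∑ U with U ≤ H ⊓ LinearMap.ker l, G U +
      ∑ U with U ≤ H ∧ ¬ U ≤ LinearMap.ker l, G U := by
  rw [← Finset.sum_filter_add_sum_filter_not _ (fun U => U ≤ LinearMap.ker l),
    Finset.filter_filter, Finset.filter_filter]
  simp only [le_inf_iff]

end Hyperplane

/-! ### Summation by thresholds -/

section Threshold

/-- The successive differences of a sequence. -/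
def increments {R : Type*} [Sub R] {n : ℕ} (N : Fin (n + 1) → R) : Fin (n + 1) → R :=
  Fin.cases (N 0) fun j => N j.succ - N j.castSucc

lemma map_increments {R S : Type*} [CommRing R] [CommRing S] (f : R →+* S) {n : ℕ}
    (N : Fin (n + 1) → R) (j : Fin (n + 1)) :
    f (increments N j) = increments (fun j => f (N j)) j := by
  cases j using Fin.cases <;> simp [increments]

/-- Group the sum by the value of `thr`. The vectors up to a threshold form a subspace section and
are easy to count, so the exact counts are taken as differences of cumulative ones. -/
lemma mul_sum_comp_threshold {R X : Type*} [CommRing R] {n : ℕ} (S : Finset X)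
    (thr : X → Fin (n + 1)) (c : R) (N : Fin (n + 1) → R)
    (hN : ∀ j, c * ((S.filter fun x => thr x ≤ j).card : R) = N j) (g : Fin (n + 1) → R) :
    c * ∑ x ∈ S, g (thr x) = ∑ j, increments N j * g j := by
  classical
  rw [← Finset.sum_fiberwise (s := S) (g := thr), Finset.mul_sum]
  refine Finset.sum_congr rfl fun j _ => ?_
  rw [Finset.sum_congr rfl (g := fun _ => g j)
    (fun x hx => by rw [(Finset.mem_filter.1 hx).2]), Finset.sum_const, nsmul_eq_mul, ← mul_assoc]
  congr 1
  cases j using Fin.cases with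
  | zero =>
    simp only [increments, Fin.cases_zero, ← hN]
    simp only [Fin.le_zero_iff]
  | succ j =>
    simp only [increments, Fin.cases_succ, ← hN]
    rw [eq_sub_iff_add_eq, ← mul_add, ← Nat.cast_add]
    congr 2
    rw [← Finset.card_union_of_disjoint]
    · congr 1
      ext x
      simp only [Finset.mem_union, Finset.mem_filter, ← and_or_left]
      refine and_congr_right fun _ => ?_
      simp only [Fin.le_def, Fin.ext_iff, Fin.val_succ, Fin.val_castSucc]
      omega
    · rw [Finset.disjoint_left]
      intro x hx hx'
      simp only [Finset.mem_filter, Fin.le_def, Fin.ext_iff, Fin.val_succ,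
        Fin.val_castSucc] at hx hx'
      omega

lemma exists_threshold {X : Type*} {n : ℕ} (Z : Fin (n + 1) → Set X) (hZ : Monotone Z) (x : X)
    (hx : x ∈ Z (Fin.last n)) : ∃ j, ∀ j', x ∈ Z j' ↔ j ≤ j' := by
  classical
  obtain ⟨j, hj, hmin⟩ := WellFounded.has_min (wellFounded_lt (α := Fin (n + 1)))
    {j | x ∈ Z j} ⟨_, hx⟩
  exact ⟨j, fun j' => ⟨fun h => not_lt.1 (hmin j' h), fun h => hZ h hj⟩⟩

end Threshold

/-! ### Powers of `q` as specialisations -/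

section Specialization

lemma mono_add (a a' b b' : ℤ) : mono (a + a') (b + b') = mono a b * mono a' b' := by
  simp only [mono, LaurentPolynomial.T_add, map_mul]
  ring

@[simp]
lemma mono_zero : mono 0 0 = 1 := by simp [mono]

/-- The power `v ^ (2 * k)`, which specialises to `q ^ k`. -/
def qPow (k : ℤ) : LaurentRing := mono (2 * k) 0

lemma qPow_add (a b : ℤ) : qPow (a + b) = qPow a * qPow b := by
  rw [qPow, qPow, qPow, ← mono_add]
  congr 1; ring

@[simp]
lemma qPow_zero : qPow 0 = 1 := by simp [qPow]

lemma algebraMap_mono (q : OddPrimePower) (a : ℤ) :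
    algebraMap LaurentRing (Coeff q) (mono a 0) =
      (LaurentPolynomial.C ((q.sqrtUnit ^ a : ℝˣ) : ℝ) : LaurentPolynomial ℝ) := by
  change (LaurentPolynomial.eval₂
      (LaurentPolynomial.C.comp (LaurentPolynomial.eval₂ (Int.castRingHom ℝ) q.sqrtUnit))
      (LaurentPolynomial.isUnit_T 1).unit :
    LaurentRing →+* LaurentPolynomial ℝ) (mono a 0) = _
  rw [mono, map_mul, LaurentPolynomial.eval₂_C, LaurentPolynomial.T_zero, map_one, mul_one,
    RingHom.comp_apply, LaurentPolynomial.eval₂_T]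

lemma algebraMap_qPow (q : OddPrimePower) (k : ℕ) :
    algebraMap LaurentRing (Coeff q) (qPow k) = (q.card : Coeff q) ^ k := by
  induction k with
  | zero => simp
  | succ k ih =>
    rw [Nat.cast_succ, qPow_add, map_mul, ih, pow_succ]
    congr 1
    rw [qPow, algebraMap_mono]
    have : ((q.sqrtUnit ^ (2 * 1 : ℤ) : ℝˣ) : ℝ) = q.card := by
      change ((q.sqrtUnit ^ (2 : ℕ) : ℝˣ) : ℝ) = q.card
      rw [Units.val_pow_eq_pow_val]
      exact Real.sq_sqrt (Nat.cast_nonneg _)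
    rw [this, map_natCast]
    rfl

lemma algebraMap_qPow_neg_mul (q : OddPrimePower) (k : ℕ) :
    algebraMap LaurentRing (Coeff q) (qPow (-k)) * (q.card : Coeff q) ^ k = 1 := by
  rw [← algebraMap_qPow, ← map_mul, ← qPow_add, neg_add_cancel, qPow_zero, map_one]

end Specialization

/-! ### Tables of intersection dimensions under a hyperplane cut -/

/-- Tables of dimensions of intersections with a pair of flags. -/
abbrev Grid (n : ℕ) : Type := Fin (n + 1) → Fin (n + 1) → ℕ

/-- The table with value `1` at the positions `(i', j')` with `i ≤ i'` and `j ≤ j'`. -/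
def corner {n : ℕ} (i j : Fin (n + 1)) : Grid n := fun i' j' => if i ≤ i' ∧ j ≤ j' then 1 else 0

namespace StepFlag

variable {n d : ℕ} {F : Type} [Field F] (V V' : StepFlag n d F)

/-- The dimensions of the intersections of `U` with `V i ⊓ V' j`. -/
def grid (U : Submodule F (Fin d → F)) : Grid n := fun i j =>
  Module.finrank F ↥(U ⊓ V.sub i ⊓ V'.sub j)

variable {V V'}

open Classical in
lemma grid_eq_add (l : (Fin d → F) →ₗ[F] F) (U : Submodule F (Fin d → F)) (i j : Fin (n + 1)) :
    V.grid V' U i j = V.grid V' (U ⊓ LinearMap.ker l) i j +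
      if U ⊓ V.sub i ⊓ V'.sub j ≤ LinearMap.ker l then 0 else 1 := by
  rw [grid, finrank_eq_finrank_inf_ker l]
  congr 1
  rw [grid, inf_right_comm U (LinearMap.ker l), inf_right_comm (U ⊓ V.sub i)]

/-- The functional `l` kills `H ∩ V_i' ∩ V'_j'` when `i'` or `j'` lies below the cut. Otherwise this
intersection contains `H ∩ V'_{j+1}`, because `H ≤ V_{i+1}`, and its dimension drops by one. -/
lemma grid_hyperplane {H : Submodule F (Fin d → F)} {l : (Fin d → F) →ₗ[F] F} {i j : Fin n}
    (hi : H ≤ V.sub i.succ) (hl : V.sub i.castSucc ≤ LinearMap.ker l)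
    (hj : H ⊓ V'.sub j.castSucc ≤ V.sub i.castSucc)
    (hj' : ¬ H ⊓ V'.sub j.succ ≤ LinearMap.ker l) :
    V.grid V' H = V.grid V' (H ⊓ LinearMap.ker l) + corner i.succ j.succ := by
  classical
  ext i' j'
  rw [grid_eq_add l, Pi.add_apply, Pi.add_apply, corner, ← ite_not]
  congr 2
  apply propext
  constructor
  · intro h
    by_contra hc
    rw [not_and_or, not_le, not_le, ← Fin.le_castSucc_iff, ← Fin.le_castSucc_iff] at hc
    apply h
    rcases hc with hc | hc
    · exact (inf_le_left.trans inf_le_right).trans ((V.mono hc).trans hl)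
    · exact (inf_le_inf (inf_le_left (b := V.sub i')) (V'.mono hc)).trans (hj.trans hl)
  · rintro ⟨h1, h2⟩ h
    refine hj' (le_trans ?_ h)
    exact inf_le_inf (le_inf le_rfl (hi.trans (V.mono h1))) (V'.mono h2)

/-- The dimension grows where `U + ⟨x⟩` meets `V_i' ∩ V'_j'` outside `ker l`. Up to scaling this
needs an element of `x + U` in `V'_j'`, that is, `x ∈ U + V'_j'`. Membership in `V_i'` is automatic
from `i + 1` on and impossible before, since `V_i ≤ ker l`. -/
lemma grid_sup_span {H : Submodule F (Fin d → F)} {l : (Fin d → F) →ₗ[F] F} {i : Fin n}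
    (hi : H ≤ V.sub i.succ) (hl : V.sub i.castSucc ≤ LinearMap.ker l)
    {U : Submodule F (Fin d → F)} (hU : U ≤ H ⊓ LinearMap.ker l) {x : Fin d → F} (hx : x ∈ H)
    (hlx : l x = 1) {j : Fin (n + 1)} (hj : ∀ j', x ∈ U ⊔ V'.sub j' ↔ j ≤ j') :
    V.grid V' (U ⊔ F ∙ x) = V.grid V' U + corner i.succ j := by
  classical
  ext i' j'
  rw [grid_eq_add l, Pi.add_apply, Pi.add_apply, corner, ← ite_not,
    sup_span_inf_ker l (hU.trans inf_le_right) hlx]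
  congr 2
  apply propext
  rw [← hj]
  constructor
  · intro h
    obtain ⟨y, ⟨⟨hyU, hyV⟩, hyV'⟩, hly⟩ := Set.not_subset.1 h
    refine ⟨?_, ?_⟩
    · by_contra hc
      rw [not_le, ← Fin.le_castSucc_iff] at hc
      exact hly (hl (V.mono hc hyV))
    · obtain ⟨u, hu, z, hz, rfl⟩ := Submodule.mem_sup.1 hyU
      obtain ⟨c, rfl⟩ := Submodule.mem_span_singleton.1 hz
      have hc : c ≠ 0 := by
        rintro rfl
        exact hly (by simpa using (hU hu).2)
      have : x = -(c⁻¹ • u) + c⁻¹ • (u + c • x) := by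
        rw [smul_add, smul_smul, inv_mul_cancel₀ hc, one_smul, neg_add_cancel_left]
      rw [this]
      exact Submodule.add_mem_sup (U.neg_mem (U.smul_mem _ hu)) (Submodule.smul_mem _ _ hyV')
  · rintro ⟨h1, h2⟩ h
    obtain ⟨u, hu, y, hy, rfl⟩ := Submodule.mem_sup.1 h2
    have hlu : l u = 0 := (hU hu).2
    have hyU : y ∈ U ⊔ F ∙ (u + y) := by
      have : y = -u + (u + y) := by abel
      rw [this]
      exact Submodule.add_mem_sup (U.neg_mem hu)
        (by simpa only [← this] using Submodule.mem_span_singleton_self (u + y))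
    have hyH : y ∈ H := by simpa using H.sub_mem hx (hU hu).1
    have : l y = 0 := h ⟨⟨hyU, V.mono h1 (hi hyH)⟩, hy⟩
    rw [map_add, hlu, this, add_zero] at hlx
    exact zero_ne_one hlx

open Classical in
-- By the modular law the condition becomes `x ∈ U + H ∩ V'_j'` with `l x = 1`. This is empty below
-- the cut and a coset of `U + (H ∩ ker l ∩ V'_j')` above it, whose size follows from the dimension
-- formula. The product form avoids a negative exponent.
lemma card_threshold [Fintype F] {H : Submodule F (Fin d → F)} {l : (Fin d → F) →ₗ[F] F}
    {i j : Fin n} (hl : V.sub i.castSucc ≤ LinearMap.ker l)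
    (hj : H ⊓ V'.sub j.castSucc ≤ V.sub i.castSucc)
    (hj' : ¬ H ⊓ V'.sub j.succ ≤ LinearMap.ker l)
    {U : Submodule F (Fin d → F)} (hU : U ≤ H ⊓ LinearMap.ker l) (j' : Fin (n + 1)) :
    (Finset.univ.filter fun x => (x ∈ H ∧ l x = 1) ∧ x ∈ U ⊔ V'.sub j').card *
      Fintype.card F ^ V.grid V' U (Fin.last n) j' =
      if j.succ ≤ j' then Fintype.card F ^ (Module.finrank F U +
        V.grid V' (H ⊓ LinearMap.ker l) (Fin.last n) j') else 0 := by
  have hmem : ∀ x, ((x ∈ H ∧ l x = 1) ∧ x ∈ U ⊔ V'.sub j') ↔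
      (x ∈ U ⊔ H ⊓ V'.sub j' ∧ l x = 1) := by
    intro x
    rw [inf_comm H, ← sup_inf_assoc_of_le _ (hU.trans inf_le_left), Submodule.mem_inf]
    tauto
  simp_rw [hmem]
  split_ifs with h
  · rw [card_filter_eq_one l, ← pow_add]
    · congr 1
      have h1 : (U ⊔ H ⊓ V'.sub j') ⊓ LinearMap.ker l =
          U ⊔ (H ⊓ LinearMap.ker l) ⊓ V'.sub j' := by
        rw [sup_inf_assoc_of_le _ (hU.trans inf_le_right), inf_right_comm]
      have h2 : U ⊓ V'.sub j' = U ⊓ ((H ⊓ LinearMap.ker l) ⊓ V'.sub j') := by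
        rw [← inf_assoc, inf_eq_left.2 hU]
      have h3 := Submodule.finrank_sup_add_finrank_inf_eq U ((H ⊓ LinearMap.ker l) ⊓ V'.sub j')
      rw [h1, grid, grid, V.last, inf_top_eq, inf_top_eq, h2, h3]
    · intro hle
      exact hj' (le_trans (le_trans (inf_le_inf_left _ (V'.mono h)) le_sup_right) hle)
  · rw [not_le, ← Fin.le_castSucc_iff] at h
    rw [Finset.card_eq_zero.2, zero_mul]
    rw [Finset.filter_eq_empty_iff]
    rintro x - ⟨hx, hlx⟩
    have hle : U ⊔ H ⊓ V'.sub j' ≤ LinearMap.ker l :=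
      sup_le (hU.trans inf_le_right)
        ((inf_le_inf_left _ (V'.mono h)).trans (hj.trans hl))
    have : l x = 0 := hle hx
    rw [this] at hlx
    exact zero_ne_one hlx

end StepFlag

instance (q : OddPrimePower) : Fintype q.K := Fintype.ofFinite _

instance {d : ℕ} {F : Type} [Field F] [Finite F] : Fintype (Submodule F (Fin d → F)) :=
  Fintype.ofFinite _

lemma OddPrimePower.card_K (q : OddPrimePower) : Fintype.card q.K = q.card := by
  rw [Fintype.card_eq_nat_card, GaloisField.card _ _ q.pos, OddPrimePower.card]

/-- The coefficient, up to the threshold `j'`, in the recursion for sums over subspaces. -/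
def thresholdCount {n : ℕ} (j : Fin n) (a b : Grid n) (j' : Fin (n + 1)) : LaurentRing :=
  if j.succ ≤ j' then qPow (a (Fin.last n) j' - b (Fin.last n) j') else 0

namespace StepFlag

variable {n d : ℕ} {F : Type} [Field F] (V V' : StepFlag n d F)

lemma grid_last (U : Submodule F (Fin d → F)) :
    V.grid V' U (Fin.last n) (Fin.last n) = Module.finrank F U := by
  rw [grid, V.last, V'.last, inf_top_eq, inf_top_eq]

/-- The position at which a subspace with the table `a` of intersection dimensions is cut down by
a hyperplane. -/
def IsCut (a : Grid n) (i j : Fin n) : Prop :=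
  a i.succ (Fin.last n) = a (Fin.last n) (Fin.last n) ∧
    a i.castSucc j.castSucc = a (Fin.last n) j.castSucc ∧
    a i.castSucc j.succ < a (Fin.last n) j.succ

variable {V V'}

lemma le_sub_iff (U : Submodule F (Fin d → F)) (i j : Fin (n + 1)) :
    U ⊓ V'.sub j ≤ V.sub i ↔ V.grid V' U i j = V.grid V' U (Fin.last n) j := by
  have h1 : U ⊓ V.sub i ⊓ V'.sub j ≤ U ⊓ V.sub (Fin.last n) ⊓ V'.sub j :=
    inf_le_inf_right _ (inf_le_inf_left _ (V.mono (Fin.le_last _)))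
  rw [grid, grid]
  constructor
  · intro h
    have : U ⊓ V.sub i ⊓ V'.sub j = U ⊓ V.sub (Fin.last n) ⊓ V'.sub j := ?_
    · rw [this]
    refine le_antisymm h1 (le_inf (le_inf (inf_le_left.trans inf_le_left) ?_) inf_le_right)
    exact le_trans (inf_le_inf_right _ inf_le_left) h
  · intro h
    have := Submodule.eq_of_le_of_finrank_eq h1 h
    rw [V.last, inf_top_eq] at this
    rw [← this]
    exact inf_le_left.trans inf_le_right

/-- Take `i` where the flag `V` first contains `H`, then `j` where `H ∩ V'_{j+1}` first leaves
`V_i`. -/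
lemma exists_isCut {H : Submodule F (Fin d → F)} (hH : H ≠ ⊥) :
    ∃ i j, IsCut (V.grid V' H) i j := by
  classical
  obtain ⟨i, hi⟩ : ∃ i : Fin n, H ≤ V.sub i.succ ∧ ¬ H ≤ V.sub i.castSucc := by
    by_contra! hc
    have : ∀ i, H ≤ V.sub i := fun i =>
      Fin.reverseInduction (by rw [V.last]; exact le_top) (fun i hi => hc i hi) i
    exact hH (by simpa [V.zero] using this 0)
  obtain ⟨j, hj⟩ : ∃ j : Fin n, H ⊓ V'.sub j.castSucc ≤ V.sub i.castSucc ∧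
      ¬ H ⊓ V'.sub j.succ ≤ V.sub i.castSucc := by
    by_contra! hc
    have : ∀ j, H ⊓ V'.sub j ≤ V.sub i.castSucc := fun j =>
      Fin.induction (by rw [V'.zero]; simp) (fun j hj => hc j hj) j
    exact hi.2 (by simpa [V'.last] using this (Fin.last n))
  refine ⟨i, j, ?_, (le_sub_iff _ _ _).1 hj.1, lt_of_le_of_ne ?_ ?_⟩
  · rw [← le_sub_iff, V'.last, inf_top_eq]
    exact hi.1
  · exact Submodule.finrank_mono
      (inf_le_inf_right _ (inf_le_inf_left _ (V.mono (Fin.le_last _))))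
  · rw [Ne, ← le_sub_iff]
    exact hj.2

/-- The cut position is a condition on the table alone, so it can be chosen uniformly in `q`, the
flags and `H`; only the functional depends on the actual subspaces. -/
lemma IsCut.spec {H : Submodule F (Fin d → F)} {i j : Fin n} (h : IsCut (V.grid V' H) i j) :
    ∃ l : (Fin d → F) →ₗ[F] F, H ≤ V.sub i.succ ∧ V.sub i.castSucc ≤ LinearMap.ker l ∧
      H ⊓ V'.sub j.castSucc ≤ V.sub i.castSucc ∧ ¬ H ⊓ V'.sub j.succ ≤ LinearMap.ker l := by
  have h3 : ¬ H ⊓ V'.sub j.succ ≤ V.sub i.castSucc := fun hle =>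
    h.2.2.ne ((le_sub_iff _ _ _).1 hle)
  obtain ⟨e, he, heV⟩ := Set.not_subset.1 h3
  obtain ⟨l, hle, hl⟩ := Submodule.exists_le_ker_of_notMem heV
  refine ⟨l, ?_, hl, (le_sub_iff _ _ _).2 h.2.1, fun hc => hle (hc he)⟩
  simpa [V'.last] using (le_sub_iff (V := V) (V' := V') H i.succ (Fin.last n)).2 h.1

end StepFlag

/-! ### Generic sums over subspaces, chains and flags -/

open StepFlag

open Classical in
lemma sum_cut {n d : ℕ} (w : Grid n → LaurentRing) (q : OddPrimePower) {V V' : StepFlag n d q.K}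
    {H : Submodule q.K (Fin d → q.K)} {l : (Fin d → q.K) →ₗ[q.K] q.K} {i j : Fin n}
    (hi : H ≤ V.sub i.succ) (hl : V.sub i.castSucc ≤ LinearMap.ker l)
    (hj : H ⊓ V'.sub j.castSucc ≤ V.sub i.castSucc)
    (hj' : ¬ H ⊓ V'.sub j.succ ≤ LinearMap.ker l) :
    ∑ U with U ≤ H, algebraMap LaurentRing (Coeff q) (w (V.grid V' U)) =
      ∑ U with U ≤ H ⊓ LinearMap.ker l, algebraMap LaurentRing (Coeff q) (w (V.grid V' U)) +
      ∑ U with U ≤ H ⊓ LinearMap.ker l, algebraMap LaurentRing (Coeff q)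
        (∑ j', increments (thresholdCount j (V.grid V' (H ⊓ LinearMap.ker l)) (V.grid V' U)) j' *
          w (V.grid V' U + corner i.succ j')) := by
  rw [sum_le_eq_add l H]
  congr 1
  rw [sum_not_le_ker (fun k => algebraMap LaurentRing (Coeff q) (qPow (-k)))
    (fun k => by rw [q.card_K, algebraMap_qPow_neg_mul]) l H]
  refine Finset.sum_congr rfl fun U hU => ?_
  have hU := (Finset.mem_filter.1 hU).2
  have hthr : ∀ x, ∃ j, ∀ j', x ∈ U ⊔ V'.sub j' ↔ j ≤ j' := by
    intro x
    refine exists_threshold (fun j => ((U ⊔ V'.sub j : Submodule q.K (Fin d → q.K)) : Set _))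
      (fun a b hab => sup_le_sup_left (V'.mono hab) U) x ?_
    simp [V'.last]
  choose thr hthr using hthr
  rw [Finset.sum_congr rfl (g := fun x => algebraMap LaurentRing (Coeff q)
    (w (V.grid V' U + corner i.succ (thr x)))) (fun x hx => by
      have hx := (Finset.mem_filter.1 hx).2
      rw [grid_sup_span hi hl hU hx.1 hx.2 (hthr x)])]
  rw [map_sum]
  simp_rw [map_mul, map_increments]
  refine mul_sum_comp_threshold _ thr _ _ (fun j' => ?_)
    (fun j' => algebraMap LaurentRing (Coeff q) (w (V.grid V' U + corner i.succ j')))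
  simp_rw [← hthr]
  rw [Finset.filter_filter]
  have hcard := congrArg (Nat.cast (R := Coeff q)) (card_threshold hl hj hj' hU j')
  rw [q.card_K] at hcard
  push_cast at hcard
  have hinv := algebraMap_qPow_neg_mul q (V.grid V' U (Fin.last n) j')
  rw [← mul_one (Nat.cast (R := Coeff q) _), ← hinv, mul_left_comm (Nat.cast (R := Coeff q) _), hcard,
    thresholdCount]
  split_ifs
  · rw [← algebraMap_qPow, ← map_mul, ← map_mul, ← qPow_add, ← qPow_add]
    congr 2
    push_cast
    ring
  · rw [mul_zero, mul_zero, map_zero]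

theorem exists_sum_subspaces (n d m : ℕ) (w : Grid n → LaurentRing) :
    ∃ w' : Grid n → LaurentRing, ∀ (q : OddPrimePower) (V V' : StepFlag n d q.K)
      (H : Submodule q.K (Fin d → q.K)), Module.finrank q.K H = m → ∀ [DecidablePred (· ≤ H)],
      ∑ U with U ≤ H, algebraMap LaurentRing (Coeff q) (w (V.grid V' U)) =
        algebraMap LaurentRing (Coeff q) (w' (V.grid V' H)) := by
  classical
  induction m generalizing w with
  | zero =>
    refine ⟨w, fun q V V' H hH _ => ?_⟩
    obtain rfl := Submodule.finrank_eq_zero.1 hH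
    simp [Finset.filter_eq']
  | succ m ih =>
    obtain ⟨w₁, hw₁⟩ := ih w
    -- The weight for subspaces outside the hyperplane involves the table `a` of the hyperplane
    -- itself, so `a` is a parameter here. It is later set equal to the argument at which `w₂ i j a`
    -- is evaluated.
    choose w₂ hw₂ using fun (i j : Fin n) (a : Grid n) => ih fun b =>
      ∑ j', increments (thresholdCount j a b) j' * w (b + corner i.succ j')
    -- Subtracting the corner from the table of `H` gives the table of the hyperplane. The default
    -- `0` is never reached, since a nonzero `H` has a cut.
    refine ⟨fun a => if h : ∃ p : Fin n × Fin n, IsCut a p.1 p.2 then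
      w₁ (a - corner h.choose.1.succ h.choose.2.succ) +
        w₂ h.choose.1 h.choose.2 (a - corner h.choose.1.succ h.choose.2.succ)
          (a - corner h.choose.1.succ h.choose.2.succ) else 0, fun q V V' H hH _ => ?_⟩
    have h : ∃ p : Fin n × Fin n, IsCut (V.grid V' H) p.1 p.2 := by
      have hne : H ≠ ⊥ := by
        rintro rfl
        simp at hH
      obtain ⟨i, j, hij⟩ := exists_isCut (V := V) (V' := V') hne
      exact ⟨(i, j), hij⟩
    beta_reduce
    rw [dif_pos h]
    obtain ⟨l, hi, hl, hj, hj'⟩ := h.choose_spec.spec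
    generalize h.choose = p at hi hl hj hj'
    have hgrid := grid_hyperplane hi hl hj hj'
    have hsub : V.grid V' H - corner p.1.succ p.2.succ = V.grid V' (H ⊓ LinearMap.ker l) := by
      rw [hgrid]
      ext
      simp
    have hfin : Module.finrank q.K ↥(H ⊓ LinearMap.ker l) = m := by
      have := finrank_eq_finrank_inf_ker l H
      rw [if_neg fun hc => hj' (inf_le_left.trans hc)] at this
      omega
    rw [hsub, map_add, ← hw₁ q V V' _ hfin, ← hw₂ _ _ _ q V V' _ hfin]
    convert sum_cut w q hi hl hj hj'

open Classical in
theorem exists_sum_subspaces_le (n d : ℕ) (w : Grid n → LaurentRing) :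
    ∃ w' : Grid n → LaurentRing, ∀ (q : OddPrimePower) (V V' : StepFlag n d q.K)
      (H : Submodule q.K (Fin d → q.K)),
      ∑ U with U ≤ H, algebraMap LaurentRing (Coeff q) (w (V.grid V' U)) =
        algebraMap LaurentRing (Coeff q) (w' (V.grid V' H)) := by
  choose w' hw' using fun m => exists_sum_subspaces n d m w
  refine ⟨fun a => w' (a (Fin.last n) (Fin.last n)) a, fun q V V' H => ?_⟩
  beta_reduce
  rw [grid_last]
  exact hw' _ q V V' H rfl

open Classical in
-- Once the largest member `U 0` is fixed, the sum over the rest of the chain depends only on the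
-- table of `U 0`, which leaves a sum over a single subspace of `H`.
theorem exists_sum_chains (n d m : ℕ) (w : (Fin m → Grid n) → LaurentRing) :
    ∃ w' : Grid n → LaurentRing, ∀ (q : OddPrimePower) (V V' : StepFlag n d q.K)
      (H : Submodule q.K (Fin d → q.K)),
      ∑ U : Fin m → Submodule q.K (Fin d → q.K) with Antitone (Matrix.vecCons H U),
        algebraMap LaurentRing (Coeff q) (w fun k => V.grid V' (U k)) =
        algebraMap LaurentRing (Coeff q) (w' (V.grid V' H)) := by
  induction m with
  | zero =>
    refine ⟨fun _ => w ![], fun q V V' H => ?_⟩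
    rw [Finset.filter_true_of_mem (fun U _ => Subsingleton.antitone (α := Fin 1) _),
      Fintype.sum_unique]
    congr 2
    exact Subsingleton.elim _ _
  | succ m ih =>
    choose w₁ hw₁ using fun a => ih fun g => w (Matrix.vecCons a g)
    obtain ⟨w', hw'⟩ := exists_sum_subspaces_le n d fun a => w₁ a a
    refine ⟨w', fun q V V' H => ?_⟩
    rw [← hw']
    simp_rw [← hw₁]
    rw [Finset.sum_sigma']
    refine Finset.sum_bij' (fun U _ => ⟨U 0, fun k => U k.succ⟩)
      (fun p _ => Matrix.vecCons p.1 p.2) ?_ ?_ ?_ ?_ ?_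
    · intro U hU
      have hU := (Finset.mem_filter.1 hU).2
      rw [antitone_vecCons] at hU
      simp only [Finset.mem_sigma, Finset.mem_filter, Finset.mem_univ, true_and]
      refine ⟨hU.1, ?_⟩
      convert hU.2
      exact Matrix.cons_head_tail U
    · rintro ⟨U, W⟩ h
      simp only [Finset.mem_sigma, Finset.mem_filter, Finset.mem_univ, true_and] at h ⊢
      exact antitone_vecCons.2 h
    · intro U _
      exact Matrix.cons_head_tail U
    · rintro ⟨U, W⟩ _
      rfl
    · intro U _
      congr 2
      ext k : 1
      cases k using Fin.cases <;> rfl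

theorem exists_sum_flags (n d : ℕ) (w : (Fin (n + 1) → Grid n) → LaurentRing) :
    ∃ w' : Grid n → LaurentRing, ∀ (q : OddPrimePower) (V V' : StepFlag n d q.K),
      ∑ V'' : StepFlag n d q.K,
        algebraMap LaurentRing (Coeff q) (w fun k => V.grid V' (V''.sub k)) =
        algebraMap LaurentRing (Coeff q) (w' (V.grid V' ⊤)) := by
  classical
  -- A flag read downwards is a chain below `⊤` ending in `⊥`. The last condition is imposed by
  -- giving weight `0` to chains whose last member has nonzero dimension.
  choose w' hw' using fun a => exists_sum_chains n d n fun g =>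
    if Matrix.vecCons a g (Fin.last n) (Fin.last n) (Fin.last n) = 0 then
      w fun k => Matrix.vecCons a g k.rev else 0
  refine ⟨fun a => w' a a, fun q V V' => ?_⟩
  rw [← hw']
  have hcons : ∀ (U : Fin n → Submodule q.K (Fin d → q.K)) k,
      Matrix.vecCons (V.grid V' ⊤) (fun k => V.grid V' (U k)) k =
        V.grid V' (Matrix.vecCons ⊤ U k) := by
    intro U k
    cases k using Fin.cases <;> rfl
  simp_rw [hcons, grid_last, Submodule.finrank_eq_zero, apply_ite (algebraMap _ _), map_zero]
  rw [← Finset.sum_filter, Finset.filter_filter]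
  have hflag : ∀ V'' : StepFlag n d q.K, (Matrix.vecCons ⊤ fun k : Fin n => V''.sub k.succ.rev) =
      fun k => V''.sub k.rev := by
    intro V''
    ext k : 1
    cases k using Fin.cases with
    | zero => simp [V''.last]
    | succ k => rfl
  refine Finset.sum_bij' (fun V'' _ k => V''.sub k.succ.rev)
    (fun U hU =>
      { sub := fun k => Matrix.vecCons ⊤ U k.rev
        mono := fun a b hab => (Finset.mem_filter.1 hU).2.1 (Fin.rev_le_rev.2 hab)
        zero := by rw [Fin.rev_zero]; exact (Finset.mem_filter.1 hU).2.2
        last := by rw [Fin.rev_last]; rfl }) ?_ ?_ ?_ ?_ ?_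
  · intro V'' _
    simp only [Finset.mem_filter, Finset.mem_univ, true_and, hflag]
    exact ⟨fun a b hab => V''.mono (Fin.rev_le_rev.2 hab), by rw [Fin.rev_last, V''.zero]⟩
  · intros
    exact Finset.mem_univ _
  · intro V'' _
    ext1
    simp only [hflag, Fin.rev_rev]
  · intro U _
    ext k : 1
    simp
  · intro V'' _
    simp only [hflag, Fin.rev_rev]

/-! ### Relative position and dimensions of intersections -/

namespace StepFlag

variable {n d : ℕ} {F : Type} [Field F] (V V' : StepFlag n d F)

/-- The dimensions of the intersections of the members of two flags. -/
def dims : Grid n := V.grid V' ⊤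

lemma dims_apply (i j : Fin (n + 1)) :
    V.dims V' i j = Module.finrank F ↥(V.sub i ⊓ V'.sub j) := by
  rw [dims, grid, top_inf_eq]

lemma dims_zero_left (j : Fin (n + 1)) : V.dims V' 0 j = 0 := by
  rw [dims_apply, V.zero, bot_inf_eq, finrank_bot]

lemma dims_zero_right (i : Fin (n + 1)) : V.dims V' i 0 = 0 := by
  rw [dims_apply, V'.zero, inf_bot_eq, finrank_bot]

lemma dims_last_right (i : Fin (n + 1)) :
    V.dims V' i (Fin.last n) = Module.finrank F (V.sub i) := by
  rw [dims_apply, V'.last, inf_top_eq]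

lemma dims_last_left (j : Fin (n + 1)) :
    V.dims V' (Fin.last n) j = Module.finrank F (V'.sub j) := by
  rw [dims_apply, V.last, top_inf_eq]

lemma dims_eq_grid_last (V'' : StepFlag n d F) (i k : Fin (n + 1)) :
    V.dims V'' i k = V.grid V' (V''.sub k) i (Fin.last n) := by
  rw [dims_apply, grid, V'.last, inf_top_eq, inf_comm]

lemma dims_eq_grid_last_left (V'' : StepFlag n d F) (k j : Fin (n + 1)) :
    V''.dims V' k j = V.grid V' (V''.sub k) (Fin.last n) j := by
  rw [dims_apply, grid, V.last, inf_top_eq]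

/-- Each entry is the second difference of the dimension table, stated additively because
subtraction in `ℕ` truncates. -/
lemma relPos_add (i j : Fin n) :
    V.relPos V' i j + V.dims V' i.succ j.castSucc + V.dims V' i.castSucc j.succ =
      V.dims V' i.succ j.succ + V.dims V' i.castSucc j.castSucc := by
  have h : ∀ k, Module.finrank F ↥(V.sub i.castSucc ⊔ V.sub i.succ ⊓ V'.sub k) +
      V.dims V' i.castSucc k = Module.finrank F (V.sub i.castSucc) + V.dims V' i.succ k := by
    intro k
    have hle : V.sub i.castSucc ≤ V.sub i.succ := V.mono i.castSucc_lt_succ.le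
    have := Submodule.finrank_sup_add_finrank_inf_eq (V.sub i.castSucc) (V.sub i.succ ⊓ V'.sub k)
    rw [← inf_assoc, inf_eq_left.2 hle] at this
    rw [dims_apply, dims_apply, this]
  have h1 := h j.castSucc
  have h2 := h j.succ
  have h3 : Module.finrank F ↥(V.sub i.castSucc ⊔ V.sub i.succ ⊓ V'.sub j.castSucc) ≤
      Module.finrank F ↥(V.sub i.castSucc ⊔ V.sub i.succ ⊓ V'.sub j.succ) :=
    Submodule.finrank_mono
      (sup_le_sup_left (inf_le_inf_left _ (V'.mono j.castSucc_lt_succ.le)) _)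
  rw [relPos]
  omega

/-- The matrix of relative position, computed from the dimensions of intersections. -/
def relPosOfDims (a : Grid n) : Matrix (Fin n) (Fin n) ℕ := fun i j =>
  a i.succ j.succ + a i.castSucc j.castSucc - a i.succ j.castSucc - a i.castSucc j.succ

lemma relPosOfDims_dims : relPosOfDims (V.dims V') = V.relPos V' := by
  ext i j
  have := relPos_add V V' i j
  rw [relPosOfDims]
  omega

variable {V V'} in
-- Second differences and zero boundary values determine a table. Two different fields are allowed
-- because the coefficients must not depend on `q`.
lemma dims_eq_of_relPos_eq {F' : Type} [Field F'] {W W' : StepFlag n d F'}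
    (h : V.relPos V' = W.relPos W') : V.dims V' = W.dims W' := by
  ext i j
  induction i using Fin.induction generalizing j with
  | zero => rw [dims_zero_left, dims_zero_left]
  | succ i hi =>
    induction j using Fin.induction with
    | zero => rw [dims_zero_right, dims_zero_right]
    | succ j hj =>
      have h1 := relPos_add V V' i j
      have h2 := relPos_add W W' i j
      have := hi j.castSucc
      have := hi j.succ
      have := congrFun₂ h i j
      omega

lemma dims_act (g : (Fin d → F) ≃ₗ[F] (Fin d → F)) : (V.act g).dims (V'.act g) = V.dims V' := by
  ext i j
  rw [dims_apply, dims_apply, act, act]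
  dsimp only
  rw [← Submodule.map_inf _ g.injective]
  exact LinearEquiv.finrank_map_eq g _

end StepFlag

/-! ### Invariant functions form an algebra -/

lemma mem_invariantFunctions_iff {n d : ℕ} {f : Families n d} :
    f ∈ invariantFunctions n d ↔ ∃ c : Grid n → LaurentRing, ∀ (q : OddPrimePower)
      (V V' : StepFlag n d q.K), f q V V' = algebraMap LaurentRing (Coeff q) (c (V.dims V')) := by
  constructor
  · rintro ⟨-, c, hc⟩
    refine ⟨fun a => c (relPosOfDims a), fun q V V' => ?_⟩
    beta_reduce
    rw [relPosOfDims_dims, hc]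
  · rintro ⟨c, hc⟩
    refine ⟨fun q g V V' => by rw [hc, hc, dims_act], ?_⟩
    let P := Σ q : OddPrimePower, StepFlag n d q.K × StepFlag n d q.K
    -- The factorisation is over pairs of flags for all `q` at once. Matrices that occur for no pair
    -- receive the value `0`.
    have hfac : Function.FactorsThrough (fun p : P => c (p.2.1.dims p.2.2))
        (fun p : P => p.2.1.relPos p.2.2) := by
      rintro ⟨q, V, V'⟩ ⟨q', W, W'⟩ h
      exact congrArg c (dims_eq_of_relPos_eq h)
    refine ⟨Function.extend (fun p : P => p.2.1.relPos p.2.2)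
      (fun p : P => c (p.2.1.dims p.2.2)) 0, fun q V V' => ?_⟩
    rw [hfac.extend_apply 0 ⟨q, V, V'⟩, hc]

theorem mul_mem_invariantFunctions {n d : ℕ} {f g : Families n d}
    (hf : f ∈ invariantFunctions n d) (hg : g ∈ invariantFunctions n d) :
    f * g ∈ invariantFunctions n d := by
  rw [mem_invariantFunctions_iff] at hf hg ⊢
  obtain ⟨c, hc⟩ := hf
  obtain ⟨c', hc'⟩ := hg
  obtain ⟨w, hw⟩ := exists_sum_flags n d fun g =>
    c (fun i k => g k i (Fin.last n)) * c' (fun k j => g k (Fin.last n) j)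
  refine ⟨w, fun q V V' => ?_⟩
  rw [dims, ← hw, Pi.mul_apply, Matrix.mul_apply]
  refine Finset.sum_congr rfl fun V'' _ => ?_
  rw [hc, hc', ← map_mul]
  congr 3
  · ext i k
    exact dims_eq_grid_last V V' V'' i k
  · ext k j
    exact dims_eq_grid_last_left V V' V'' k j

lemma eq_iff_dims {n d : ℕ} {F : Type} [Field F] (V V' : StepFlag n d F) :
    V = V' ↔ ∀ i, V.dims V' i i = V.dims V' i (Fin.last n) ∧
      V.dims V' i i = V.dims V' (Fin.last n) i := by
  simp_rw [dims_last_left, dims_last_right, dims_apply]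
  constructor
  · rintro rfl i
    rw [inf_idem]
    exact ⟨rfl, rfl⟩
  · intro h
    ext1
    ext1 i
    rw [← Submodule.eq_of_le_of_finrank_eq inf_le_left (h i).1]
    exact Submodule.eq_of_le_of_finrank_eq inf_le_right (h i).2

theorem one_mem_invariantFunctions (n d : ℕ) : (1 : Families n d) ∈ invariantFunctions n d := by
  classical
  rw [mem_invariantFunctions_iff]
  refine ⟨fun a => if ∀ i, a i i = a i (Fin.last n) ∧ a i i = a (Fin.last n) i then 1 else 0,
    fun q V V' => ?_⟩
  rw [Pi.one_apply, Matrix.one_apply]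
  simp only [eq_iff_dims V V']
  split_ifs <;> simp

theorem toSubmodule_schurAlgebra (n d : ℕ) :
    Subalgebra.toSubmodule (schurAlgebra n d) = invariantFunctions n d := by
  have h := Submodule.toSubalgebra_toSubmodule (invariantFunctions n d)
    (one_mem_invariantFunctions n d) fun _ _ => mul_mem_invariantFunctions
  refine le_antisymm ?_ (fun f hf => Algebra.subset_adjoin hf)
  rw [← h]
  exact Algebra.adjoin_le fun f hf => hf

/-! ### Changing one member of a flag by one dimension -/

namespace StepFlag

variable {n d : ℕ} {F : Type} [Field F] {V V' V'' : StepFlag n d F}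

/-- The flag with `V k` replaced by `U`. -/
def replace (V : StepFlag n d F) (k : Fin (n + 1)) (U : Submodule F (Fin d → F)) (h0 : k ≠ 0)
    (hlast : k ≠ Fin.last n) (hlow : ∀ i < k, V.sub i ≤ U) (hup : ∀ i, k < i → U ≤ V.sub i) :
    StepFlag n d F where
  sub := Function.update V.sub k U
  mono a b hab := by
    rcases eq_or_ne a k with ha | ha <;> rcases eq_or_ne b k with hb | hb
    · rw [ha, hb]
    · rw [ha, Function.update_self, Function.update_of_ne hb]
      exact hup b (lt_of_le_of_ne (ha ▸ hab) hb.symm)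
    · rw [hb, Function.update_self, Function.update_of_ne ha]
      exact hlow a (lt_of_le_of_ne (hb ▸ hab) ha)
    · rw [Function.update_of_ne ha, Function.update_of_ne hb]
      exact V.mono hab
  zero := by rw [Function.update_of_ne h0.symm, V.zero]
  last := by rw [Function.update_of_ne hlast.symm, V.last]

lemma coversAt_of_inf_ker {k : Fin (n + 1)} {l : (Fin d → F) →ₗ[F] F}
    (hk : V''.sub k = V.sub k ⊓ LinearMap.ker l) (hne : ∀ i, i ≠ k → V.sub i = V''.sub i)
    (hl : ¬ V.sub k ≤ LinearMap.ker l) : CoversAt k V V'' := by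
  classical
  refine ⟨hk ▸ inf_le_left, ?_, hne⟩
  rw [hk, finrank_eq_finrank_inf_ker l, if_neg hl]

lemma dims_eq_add {k : Fin (n + 1)} {p : Fin n} {l : (Fin d → F) →ₗ[F] F}
    (hk : V''.sub k = V.sub k ⊓ LinearMap.ker l) (hne : ∀ i, i ≠ k → V.sub i = V''.sub i)
    (hp : V.sub k ⊓ V'.sub p.castSucc ≤ LinearMap.ker l)
    (hp' : ¬ V.sub k ⊓ V'.sub p.succ ≤ LinearMap.ker l) (i j : Fin (n + 1)) :
    V.dims V' i j = V''.dims V' i j + if i = k ∧ p.succ ≤ j then 1 else 0 := by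
  classical
  rw [dims_apply, dims_apply]
  rcases eq_or_ne i k with rfl | hi
  · rw [finrank_eq_finrank_inf_ker l, hk, inf_right_comm, ← ite_not]
    simp only [true_and]
    congr 2
    apply propext
    constructor
    · intro h
      by_contra hc
      rw [not_le, ← Fin.le_castSucc_iff] at hc
      exact h ((inf_le_inf_left _ (V'.mono hc)).trans hp)
    · intro h hc
      exact hp' ((inf_le_inf_left _ (V'.mono h)).trans hc)
  · rw [hne i hi, if_neg (fun h => hi h.1), add_zero]

lemma relPos_add_single {h h' p : Fin n} (hh : (h' : ℕ) = h + 1)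
    (hD : ∀ i j, V.dims V' i j = V''.dims V' i j + if i = h.succ ∧ p.succ ≤ j then 1 else 0) :
    V.relPos V' + Matrix.single h' p 1 = V''.relPos V' + Matrix.single h p 1 := by
  ext i j
  have h1 := relPos_add V V' i j
  have h2 := relPos_add V'' V' i j
  rw [hD, hD, hD, hD] at h1
  rw [Matrix.add_apply, Matrix.add_apply, Matrix.single_apply, Matrix.single_apply]
  simp only [Fin.ext_iff, Fin.le_def, Fin.val_succ, Fin.val_castSucc] at h1 ⊢
  split_ifs at h1 ⊢ <;> omega

/-- The smaller space is a hyperplane section of `V_{h+1}`. The column `p` is the first one at which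
the intersections with `V'` leave that hyperplane. -/
lemma CoversAt.exists_relPos {h h' : Fin n} (hh : (h' : ℕ) = h + 1) (hV : CoversAt h.succ V V'')
    (V' : StepFlag n d F) :
    ∃ p, V.relPos V' + Matrix.single h' p 1 = V''.relPos V' + Matrix.single h p 1 := by
  classical
  obtain ⟨hle, hfin, hne⟩ := hV
  have hnle : ¬ V.sub h.succ ≤ V''.sub h.succ := by
    intro hc
    rw [le_antisymm hc hle] at hfin
    omega
  obtain ⟨e, he, heV⟩ := Set.not_subset.1 hnle
  obtain ⟨l, hle', hl⟩ := Submodule.exists_le_ker_of_notMem heV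
  have hk : V''.sub h.succ = V.sub h.succ ⊓ LinearMap.ker l := by
    refine Submodule.eq_of_le_of_finrank_eq (le_inf hle hl) ?_
    have := finrank_eq_finrank_inf_ker l (V.sub h.succ)
    rw [if_neg fun hc => hle' (hc he)] at this
    omega
  obtain ⟨p, hp, hp'⟩ : ∃ p : Fin n, V.sub h.succ ⊓ V'.sub p.castSucc ≤ LinearMap.ker l ∧
      ¬ V.sub h.succ ⊓ V'.sub p.succ ≤ LinearMap.ker l := by
    by_contra! hc
    have : ∀ j, V.sub h.succ ⊓ V'.sub j ≤ LinearMap.ker l := fun j =>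
      Fin.induction (by rw [V'.zero]; simp) (fun j hj => hc j hj) j
    exact hle' (by simpa [V'.last] using this (Fin.last n) (by simpa [V'.last] using he))
  exact ⟨p, relPos_add_single hh (dims_eq_add hk hne hp hp')⟩

/-- A nonzero entry provides a vector of `V_{h+1} ∩ V'_{p+1}` outside `V_h + V_{h+1} ∩ V'_p`; a
functional separates it from that space. -/
lemma exists_functional_of_relPos_ne_zero {h p : Fin n} (hM : V.relPos V' h p ≠ 0) :
    ∃ (l : (Fin d → F) →ₗ[F] F) (e : Fin d → F), e ∈ V.sub h.succ ⊓ V'.sub p.succ ∧ l e = 1 ∧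
      V.sub h.castSucc ≤ LinearMap.ker l ∧
      V.sub h.succ ⊓ V'.sub p.castSucc ≤ LinearMap.ker l := by
  have hnle : ¬ V.sub h.succ ⊓ V'.sub p.succ ≤
      V.sub h.castSucc ⊔ V.sub h.succ ⊓ V'.sub p.castSucc := by
    intro hc
    apply hM
    rw [relPos, Nat.sub_eq_zero_iff_le]
    exact Submodule.finrank_mono (sup_le le_sup_left hc)
  obtain ⟨e, he, heV⟩ := Set.not_subset.1 hnle
  obtain ⟨l, hle, hl⟩ := Submodule.exists_le_ker_of_notMem heV
  refine ⟨l, (l e)⁻¹ • e, Submodule.smul_mem _ _ he, ?_, le_sup_left.trans hl,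
    le_sup_right.trans hl⟩
  rw [map_smul, smul_eq_mul, inv_mul_cancel₀ hle]

/-- Any unit of row `h` can be moved to the next row: replace `V_{h+1}` by its intersection with the
kernel of the separating functional, which still contains `V_h`. -/
lemma exists_coversAt_lower {h h' p : Fin n} (hh : (h' : ℕ) = h + 1) (hM : V.relPos V' h p ≠ 0) :
    ∃ V'', CoversAt h.succ V V'' ∧
      V.relPos V' + Matrix.single h' p 1 = V''.relPos V' + Matrix.single h p 1 := by
  obtain ⟨l, e, he, hle, hl, hl'⟩ := exists_functional_of_relPos_ne_zero hM
  have hlast : h.succ ≠ Fin.last n := by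
    rw [Ne, Fin.ext_iff, Fin.val_succ, Fin.val_last]
    omega
  let W := V.replace h.succ (V.sub h.succ ⊓ LinearMap.ker l) (Fin.succ_ne_zero h) hlast
    (fun i hi => le_inf (V.mono hi.le) ((V.mono (Fin.le_castSucc_iff.2 hi)).trans hl))
    (fun i hi => inf_le_left.trans (V.mono hi.le))
  have hk : W.sub h.succ = V.sub h.succ ⊓ LinearMap.ker l := Function.update_self ..
  have hne : ∀ i, i ≠ h.succ → V.sub i = W.sub i := fun i hi => (Function.update_of_ne hi ..).symm
  have hel : e ∉ LinearMap.ker l := by simp [hle]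
  exact ⟨W, coversAt_of_inf_ker hk hne fun hc => hel (hc he.1),
    relPos_add_single hh (dims_eq_add hk hne hl' fun hc => hel (hc he))⟩

/-- Moving a unit to the previous row means enlarging the space between the two rows by the
separated vector. -/
lemma exists_coversAt_upper {h h' p : Fin n} (hh : (h : ℕ) = h' + 1) (hM : V.relPos V' h p ≠ 0) :
    ∃ V'', CoversAt h'.succ V'' V ∧
      V.relPos V' + Matrix.single h' p 1 = V''.relPos V' + Matrix.single h p 1 := by
  obtain ⟨l, e, he, hle, hl, hl'⟩ := exists_functional_of_relPos_ne_zero hM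
  have hcs : h.castSucc = h'.succ := Fin.ext (by simp [hh])
  rw [hcs] at hl
  have hlast : h'.succ ≠ Fin.last n := by
    rw [Ne, Fin.ext_iff, Fin.val_succ, Fin.val_last]
    omega
  have hup : V.sub h'.succ ⊔ F ∙ e ≤ V.sub h.succ :=
    sup_le (V.mono (hcs ▸ h.castSucc_lt_succ.le)) (by simpa using he.1)
  let W := V.replace h'.succ (V.sub h'.succ ⊔ F ∙ e) (Fin.succ_ne_zero h') hlast
    (fun i hi => (V.mono hi.le).trans le_sup_left)
    (fun i hi => hup.trans (V.mono (by rwa [← hcs, Fin.castSucc_lt_iff_succ_le] at hi)))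
  have hWk : W.sub h'.succ = V.sub h'.succ ⊔ F ∙ e := Function.update_self ..
  have hk : V.sub h'.succ = W.sub h'.succ ⊓ LinearMap.ker l := by
    rw [hWk, sup_span_inf_ker l hl hle]
  have hne : ∀ i, i ≠ h'.succ → W.sub i = V.sub i := fun i hi => Function.update_of_ne hi ..
  have hel : e ∉ LinearMap.ker l := by simp [hle]
  have heW : e ∈ W.sub h'.succ :=
    hWk ▸ Submodule.mem_sup_right (Submodule.mem_span_singleton_self e)
  refine ⟨W, coversAt_of_inf_ker hk hne fun hc => hel (hc heW),
    (relPos_add_single hh (dims_eq_add hk hne ?_ fun hc => hel (hc ⟨heW, he.2⟩))).symm⟩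
  exact le_trans (inf_le_inf_right _ (hWk ▸ hup)) hl'

lemma dims_comm (V V' : StepFlag n d F) (i j : Fin (n + 1)) : V.dims V' i j = V'.dims V j i := by
  rw [dims_apply, dims_apply, inf_comm]

lemma relPos_comm (V V' : StepFlag n d F) (i j : Fin n) : V.relPos V' i j = V'.relPos V j i := by
  have h1 := relPos_add V V' i j
  have h2 := relPos_add V' V j i
  simp only [dims_comm V' V] at h2
  omega

/-- Zeros above the diagonal make `dim (V_i ∩ V'_j)` constant for `j ≥ i`. The value at the last `j`
is `dim V_i`, so `V_i ∩ V'_i = V_i`. -/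
lemma sub_le_of_relPos (h : ∀ i j, i < j → V.relPos V' i j = 0) (i : Fin (n + 1)) :
    V.sub i ≤ V'.sub i := by
  have h1 : ∀ (i : Fin (n + 1)) (j : Fin n), i ≤ j.castSucc →
      V.dims V' i j.succ = V.dims V' i j.castSucc := by
    intro i
    induction i using Fin.induction with
    | zero => intro j _; rw [dims_zero_left, dims_zero_left]
    | succ i ih =>
      intro j hij
      have h2 := relPos_add V V' i j
      have h3 := ih j (i.castSucc_lt_succ.le.trans hij)
      have h4 := h i j (by
        rw [Fin.le_def, Fin.val_succ, Fin.val_castSucc] at hij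
        rw [Fin.lt_def]
        omega)
      omega
  have h2 : ∀ j, i ≤ j → V.dims V' i j = V.dims V' i i := by
    intro j
    induction j using Fin.induction with
    | zero => intro hij; rw [Fin.le_zero_iff.1 hij]
    | succ j ih =>
      intro hij
      rcases hij.eq_or_lt with rfl | hij
      · rfl
      · rw [h1 i j (Fin.le_castSucc_iff.2 hij), ih (Fin.le_castSucc_iff.2 hij)]
  have h3 := h2 _ (Fin.le_last i)
  rw [dims_last_right, dims_apply] at h3
  rw [← Submodule.eq_of_le_of_finrank_eq inf_le_left h3.symm]
  exact inf_le_right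

lemma eq_of_relPos (h : ∀ i j, i ≠ j → V.relPos V' i j = 0) : V = V' := by
  ext1
  ext1 i
  refine le_antisymm (sub_le_of_relPos (fun i j hij => h i j hij.ne) i)
    (sub_le_of_relPos (fun i j hij => ?_) i)
  rw [relPos_comm, h j i hij.ne']

lemma relPos_self (V : StepFlag n d F) : V.relPos V = Matrix.diagonal V.layer := by
  have hD : ∀ i j, i ≤ j → V.dims V i j = Module.finrank F (V.sub i) := fun i j hij => by
    rw [dims_apply, inf_eq_left.2 (V.mono hij)]
  have hlt : ∀ i j, i < j → V.relPos V i j = 0 := by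
    intro i j hij
    have h1 := relPos_add V V i j
    rw [hD _ _ (Fin.succ_le_succ_iff.2 hij.le), hD _ _ (Fin.castSucc_le_castSucc_iff.2 hij.le),
      hD _ _ (Fin.succ_le_castSucc_iff.2 hij),
      hD _ _ ((Fin.castSucc_le_castSucc_iff.2 hij.le).trans j.castSucc_lt_succ.le)] at h1
    omega
  ext i j
  rcases lt_trichotomy i j with hij | rfl | hij
  · rw [hlt i j hij, Matrix.diagonal_apply_ne _ hij.ne]
  · have h1 := relPos_add V V i i
    have h2 := hD i.castSucc i.succ i.castSucc_lt_succ.le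
    rw [dims_comm V V i.succ i.castSucc, h2, hD _ _ le_rfl, hD _ _ le_rfl] at h1
    rw [Matrix.diagonal_apply_eq, layer]
    omega
  · rw [relPos_comm, hlt j i hij, Matrix.diagonal_apply_ne _ hij.ne']

lemma relPos_eq_diagonal_iff (V V' : StepFlag n d F) (r : Fin n → ℕ) :
    V.relPos V' = Matrix.diagonal r ↔ V = V' ∧ V.layer = r := by
  constructor
  · intro h
    obtain rfl : V = V' := eq_of_relPos fun i j hij => by rw [h, Matrix.diagonal_apply_ne _ hij]
    rw [relPos_self] at h
    exact ⟨rfl, Matrix.diagonal_injective h⟩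
  · rintro ⟨rfl, rfl⟩
    exact relPos_self V

lemma relPos_le (V V' : StepFlag n d F) (i j : Fin n) : V.relPos V' i j ≤ d := by
  refine (Nat.sub_le _ _).trans ((Submodule.finrank_le _).trans_eq ?_)
  rw [Module.finrank_fin_fun]

lemma layer_le (V : StepFlag n d F) (i : Fin n) : V.layer i ≤ d := by
  refine (Nat.sub_le _ _).trans ((Submodule.finrank_le _).trans_eq ?_)
  rw [Module.finrank_fin_fun]

end StepFlag

variable {n d : ℕ}

/-! ### Diagonal functions -/

/-- The function supported on the diagonal with the value `c (layers of V)` at `(V, V)`. -/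
def diagHom (n d : ℕ) : ((Fin n → ℕ) → LaurentRing) →ₐ[LaurentRing] Families n d where
  toFun c := fun q => Matrix.diagonal fun V => algebraMap LaurentRing (Coeff q) (c V.layer)
  map_one' := by
    funext q
    simp only [Pi.one_apply, map_one, Matrix.diagonal_one]
  map_mul' c c' := by
    funext q
    simp only [Pi.mul_apply, map_mul, Matrix.diagonal_mul_diagonal]
  map_zero' := by
    funext q
    simp only [Pi.zero_apply, map_zero, Matrix.diagonal_zero]
  map_add' c c' := by
    funext q
    simp only [Pi.add_apply, map_add, Matrix.diagonal_add]
  commutes' r := by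
    funext q
    rfl

lemma diagHom_apply (c : (Fin n → ℕ) → LaurentRing) (q : OddPrimePower)
    (V V' : StepFlag n d q.K) : diagHom n d c q V V' =
      if V = V' then algebraMap LaurentRing (Coeff q) (c V.layer) else 0 :=
  Matrix.diagonal_apply ..

lemma diagHom_congr {c c' : (Fin n → ℕ) → LaurentRing} (h : ∀ r, (∀ i, r i ≤ d) → c r = c' r) :
    diagHom n d c = diagHom n d c' := by
  funext q V V'
  rw [diagHom_apply, diagHom_apply, h _ V.layer_le]

/-- Compare degrees in `t`. This separates the values of `A_a` on different layer dimensions. -/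
lemma mono_self_injective : Function.Injective fun k : ℕ => mono k k := by
  intro k l h
  have hT : ∀ m : ℕ, (LaurentPolynomial.T m : LaurentPolynomial ℤ) ≠ 0 := fun m =>
    (LaurentPolynomial.isUnit_T _).ne_zero
  have h1 := congrArg LaurentPolynomial.degree h
  simp only [mono] at h1
  rw [LaurentPolynomial.degree_C_mul_T _ _ (hT k), LaurentPolynomial.degree_C_mul_T _ _ (hT l)]
    at h1
  exact_mod_cast h1

lemma mono_neg_mul (a b : ℤ) : mono (-a) (-b) * mono a b = 1 := by
  rw [← mono_add, neg_add_cancel, neg_add_cancel, mono_zero]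

lemma genA_eq (s : ℤˣ) (a : Fin n) :
    genA (d := d) s a = diagHom n d fun r => mono (s * r a) (s * r a) := by
  funext q V V'
  rw [diagHom_apply, genA]
  split_ifs with h
  · rw [h]
  · rfl

lemma genB_eq (s : ℤˣ) (a : Fin n) :
    genB (d := d) s a = diagHom n d fun r => mono (-(s * r a)) (s * r a) := by
  funext q V V'
  rw [diagHom_apply, genB]
  split_ifs with h
  · rw [h]
  · rfl

/-- An invariant function with a nonzero multiple in `T` belongs to `T`. -/
def IsSaturated (T : Subalgebra LaurentRing (Families n d)) : Prop :=
  ∀ a : LaurentRing, a ≠ 0 → ∀ f ∈ invariantFunctions n d, a • f ∈ T → f ∈ T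

lemma layer_eq_dims {F : Type} [Field F] (V V' : StepFlag n d F) (i : Fin n) :
    V.layer i = V.dims V' i.succ (Fin.last n) - V.dims V' i.castSucc (Fin.last n) := by
  rw [dims_last_right, dims_last_right, layer]

lemma diagHom_mem_invariantFunctions (c : (Fin n → ℕ) → LaurentRing) :
    diagHom n d c ∈ invariantFunctions n d := by
  classical
  rw [mem_invariantFunctions_iff]
  refine ⟨fun a => if ∀ i, a i i = a i (Fin.last n) ∧ a i i = a (Fin.last n) i then
    c fun i => a i.succ (Fin.last n) - a i.castSucc (Fin.last n) else 0, fun q V V' => ?_⟩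
  rw [diagHom_apply]
  simp only [eq_iff_dims V V', ← layer_eq_dims V V']
  split_ifs <;> simp

/-- Lagrange interpolation. -/
theorem diagHom_mem {T : Subalgebra LaurentRing (Families n d)} (hT : IsSaturated T)
    (hA : ∀ a, genA 1 a ∈ T) (c : (Fin n → ℕ) → LaurentRing) : diagHom n d c ∈ T := by
  classical
  have hsingle : ∀ r : Fin n → ℕ, diagHom n d (Pi.single r 1) ∈ T := by
    intro r
    -- The interpolation polynomial in the `A_i`: it vanishes at every `s ≠ r` with entries at most
    -- `d` and is nonzero at `r`. Saturation then removes the factor `P r`.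
    let P : (Fin n → ℕ) → LaurentRing := ∏ i, ∏ k ∈ (Finset.range (d + 1)).erase (r i),
      ((fun s => mono (s i) (s i)) - algebraMap LaurentRing _ (mono k k))
    have hPT : P ∈ T.comap (diagHom n d) := by
      refine Subalgebra.prod_mem _ fun i _ => Subalgebra.prod_mem _ fun k _ =>
        Subalgebra.sub_mem _ ?_ (Subalgebra.algebraMap_mem _ _)
      have := hA i
      rw [genA_eq] at this
      simpa using this
    have hP : ∀ s, P s = ∏ i, ∏ k ∈ (Finset.range (d + 1)).erase (r i),
        (mono (s i) (s i) - mono k k) := by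
      intro s
      simp only [P, Finset.prod_apply]
      rfl
    have hPr : P r ≠ 0 := by
      rw [hP]
      refine Finset.prod_ne_zero_iff.2 fun i _ => Finset.prod_ne_zero_iff.2 fun k hk => ?_
      rw [sub_ne_zero]
      exact fun h => (Finset.ne_of_mem_erase hk) (mono_self_injective h).symm
    refine hT _ hPr _ (diagHom_mem_invariantFunctions _) ?_
    rw [← map_smul]
    rw [diagHom_congr (c' := P)]
    · exact hPT
    · intro s hs
      rcases eq_or_ne s r with rfl | hsr
      · simp
      · rw [Pi.smul_apply, Pi.single_eq_of_ne hsr, smul_zero, hP]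
        obtain ⟨i, hi⟩ := Function.ne_iff.1 hsr
        refine (Finset.prod_eq_zero (Finset.mem_univ i) (Finset.prod_eq_zero (i := s i) ?_ ?_)).symm
        · exact Finset.mem_erase.2 ⟨hi, Finset.mem_range.2 (Nat.lt_succ_of_le (hs i))⟩
        · exact sub_self _
  rw [diagHom_congr (c' := ∑ r ∈ Fintype.piFinset fun _ : Fin n => Finset.range (d + 1),
    c r • Pi.single r 1)]
  · rw [map_sum]
    exact Subalgebra.sum_mem _ fun r _ => by
      rw [map_smul]
      exact Subalgebra.smul_mem _ (hsingle r) _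
  · intro s hs
    rw [Finset.sum_apply, Finset.sum_eq_single s]
    · simp
    · intro r _ hr
      simp [Pi.single_eq_of_ne hr.symm]
    · intro h
      exact absurd (Fintype.mem_piFinset.2 fun i =>
        Finset.mem_range.2 (Nat.lt_succ_of_le (hs i))) h

/-! ### Raising and lowering functions -/

open Classical in
/-- The indicator function of a relation between flags. -/
def indicator (P : ∀ q : OddPrimePower, StepFlag n d q.K → StepFlag n d q.K → Prop) :
    Families n d := fun q V V' => if P q V V' then 1 else 0

lemma coversAt_iff_dims {F : Type} [Field F] (k : Fin (n + 1)) (V V' : StepFlag n d F) :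
    CoversAt k V V' ↔ V.dims V' k k = V.dims V' (Fin.last n) k ∧
      V.dims V' k (Fin.last n) = V.dims V' (Fin.last n) k + 1 ∧
      ∀ i, i ≠ k → V.dims V' i i = V.dims V' i (Fin.last n) ∧
        V.dims V' i i = V.dims V' (Fin.last n) i := by
  simp_rw [dims_last_left, dims_last_right, dims_apply, CoversAt]
  refine and_congr ?_ (and_congr_right fun _ => forall_congr' fun i => imp_congr_right fun _ => ?_)
  · constructor
    · intro h
      rw [inf_eq_right.2 h]
    · intro h
      rw [← Submodule.eq_of_le_of_finrank_eq inf_le_right h]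
      exact inf_le_left
  · constructor
    · intro h
      rw [h, inf_idem]
      exact ⟨rfl, rfl⟩
    · intro h
      rw [← Submodule.eq_of_le_of_finrank_eq inf_le_left h.1]
      exact Submodule.eq_of_le_of_finrank_eq inf_le_right h.2

lemma layer_eq_of_coversAt {F : Type} [Field F] {a : Fin n} {V V' : StepFlag n d F}
    (h : CoversAt a.succ V V') : V.layer a = V'.layer a + 1 := by
  have h1 := h.2.1
  have h2 := h.2.2 a.castSucc a.castSucc_lt_succ.ne
  have h3 : Module.finrank F (V'.sub a.castSucc) ≤ Module.finrank F (V'.sub a.succ) :=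
    Submodule.finrank_mono (V'.mono a.castSucc_lt_succ.le)
  rw [layer, layer, h1, h2]
  omega

lemma indicator_mem_invariantFunctions
    {P : ∀ q : OddPrimePower, StepFlag n d q.K → StepFlag n d q.K → Prop} (Q : Grid n → Prop)
    (h : ∀ q V V', P q V V' ↔ Q (V.dims V')) : indicator P ∈ invariantFunctions n d := by
  classical
  rw [mem_invariantFunctions_iff]
  refine ⟨fun a => if Q a then 1 else 0, fun q V V' => ?_⟩
  simp only [indicator, h]
  split_ifs <;> simp

lemma mul_diagHom_apply (f : Families n d) (c : (Fin n → ℕ) → LaurentRing) (q : OddPrimePower)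
    (V V' : StepFlag n d q.K) : (f * diagHom n d c) q V V' =
      f q V V' * algebraMap LaurentRing (Coeff q) (c V'.layer) :=
  Matrix.mul_diagonal ..

/-- The indicator function of the support of `genE`. -/
def raise (a : Fin n) : Families n d := indicator fun _ V V' => CoversAt a.succ V V'

/-- The indicator function of the support of `genF`. -/
def lower (a : Fin n) : Families n d := indicator fun _ V V' => CoversAt a.succ V' V

lemma raise_mem_invariantFunctions (a : Fin n) : raise (d := d) a ∈ invariantFunctions n d :=
  indicator_mem_invariantFunctions (fun b => b a.succ a.succ = b (Fin.last n) a.succ ∧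
      b a.succ (Fin.last n) = b (Fin.last n) a.succ + 1 ∧
      ∀ i, i ≠ a.succ → b i i = b i (Fin.last n) ∧ b i i = b (Fin.last n) i)
    fun _ V V' => coversAt_iff_dims a.succ V V'

lemma lower_mem_invariantFunctions (a : Fin n) : lower (d := d) a ∈ invariantFunctions n d := by
  refine indicator_mem_invariantFunctions (fun b => b a.succ a.succ = b a.succ (Fin.last n) ∧
      b (Fin.last n) a.succ = b a.succ (Fin.last n) + 1 ∧
      ∀ i, i ≠ a.succ → b i i = b (Fin.last n) i ∧ b i i = b i (Fin.last n)) fun _ V V' => ?_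
  rw [coversAt_iff_dims]
  simp only [dims_comm V' V]

/-- On the support, the layer of `V` exceeds that of `V'` by one, so the whole coefficient is a
function of the right-hand flag. -/
lemma genE_eq (ε : ℤˣ) (i : ℕ) (hi : i + 1 < n) : genE (d := d) ε i hi =
    raise ⟨i, by omega⟩ * diagHom n d fun r =>
      mono (-(r ⟨i, by omega⟩ : ℤ)) (ε * (r ⟨i, by omega⟩ + 1 : ℤ)) := by
  funext q V V'
  rw [mul_diagHom_apply, genE, raise, indicator]
  split_ifs with h
  · rw [one_mul, layer_eq_of_coversAt h]
    push_cast
    rfl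
  · rw [zero_mul]

lemma genF_eq (i : ℕ) (hi : i + 1 < n) : genF (d := d) i hi =
    lower ⟨i, by omega⟩ * diagHom n d fun r =>
      mono (-(r ⟨i + 1, hi⟩ : ℤ)) (r ⟨i + 1, hi⟩ : ℤ) := by
  funext q V V'
  rw [mul_diagHom_apply, genF, lower, indicator]
  split_ifs with h
  · rw [one_mul]
  · rw [zero_mul]

theorem generators_subset (ε : ℤˣ) : generators n d ε ⊆ invariantFunctions n d := by
  rintro f (⟨i, hi, rfl⟩ | ⟨i, hi, rfl⟩ | ⟨s, a, rfl⟩ | ⟨s, a, rfl⟩)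
  · rw [genE_eq]
    exact mul_mem_invariantFunctions (raise_mem_invariantFunctions _)
      (diagHom_mem_invariantFunctions _)
  · rw [genF_eq]
    exact mul_mem_invariantFunctions (lower_mem_invariantFunctions _)
      (diagHom_mem_invariantFunctions _)
  · rw [genA_eq]
    exact diagHom_mem_invariantFunctions _
  · rw [genB_eq]
    exact diagHom_mem_invariantFunctions _

/-- A diagonal function with monomial values is invertible among diagonal functions. -/
lemma mem_of_mul_diagHom_mono_mem {T : Subalgebra LaurentRing (Families n d)}
    (hT : ∀ c, diagHom n d c ∈ T) {f : Families n d} (a b : (Fin n → ℕ) → ℤ)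
    (h : (f * diagHom n d fun r => mono (a r) (b r)) ∈ T) : f ∈ T := by
  have := T.mul_mem h (hT fun r => mono (-a r) (-b r))
  rw [mul_assoc, ← map_mul] at this
  have h1 : ((fun r => mono (a r) (b r)) * fun r => mono (-a r) (-b r) :
      (Fin n → ℕ) → LaurentRing) = 1 := by
    ext1 r
    rw [Pi.mul_apply, mul_comm, mono_neg_mul, Pi.one_apply]
  rwa [h1, map_one, mul_one] at this

/-! ### Characteristic functions of orbits -/

/-- The characteristic function of the set of pairs with matrix `M`. -/
def orbitFun (n d : ℕ) (M : Matrix (Fin n) (Fin n) ℕ) : Families n d :=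
  indicator fun _ V V' => V.relPos V' = M

lemma orbitFun_mem_invariantFunctions (M : Matrix (Fin n) (Fin n) ℕ) :
    orbitFun n d M ∈ invariantFunctions n d :=
  indicator_mem_invariantFunctions (fun a => relPosOfDims a = M) fun _ V V' => by
    rw [relPosOfDims_dims]

lemma orbitFun_eq_zero {M : Matrix (Fin n) (Fin n) ℕ}
    (h : ∀ (q : OddPrimePower) (V V' : StepFlag n d q.K), V.relPos V' ≠ M) :
    orbitFun n d M = 0 := by
  funext q V V'
  rw [orbitFun, indicator, if_neg (h q V V')]
  rfl

/-- The matrices with entries at most `d`. -/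
def boundedMatrices (n d : ℕ) : Finset (Matrix (Fin n) (Fin n) ℕ) :=
  Fintype.piFinset fun _ => Fintype.piFinset fun _ => Finset.range (d + 1)

lemma relPos_mem_boundedMatrices {F : Type} [Field F] (V V' : StepFlag n d F) :
    V.relPos V' ∈ boundedMatrices n d :=
  Fintype.mem_piFinset.2 fun i => Fintype.mem_piFinset.2 fun j =>
    Finset.mem_range.2 (Nat.lt_succ_of_le (V.relPos_le V' i j))

lemma eq_sum_orbitFun {f : Families n d} {c : Matrix (Fin n) (Fin n) ℕ → LaurentRing}
    (hc : ∀ (q : OddPrimePower) (V V' : StepFlag n d q.K),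
      f q V V' = algebraMap LaurentRing (Coeff q) (c (V.relPos V'))) :
    f = ∑ M ∈ boundedMatrices n d, c M • orbitFun n d M := by
  classical
  funext q V V'
  rw [hc, Finset.sum_apply, Matrix.sum_apply, Finset.sum_eq_single (V.relPos V')]
  · rw [Pi.smul_apply, Matrix.smul_apply, orbitFun, indicator, if_pos rfl, Algebra.smul_def,
      mul_one]
  · intro M _ hM
    rw [Pi.smul_apply, Matrix.smul_apply, orbitFun, indicator, if_neg hM.symm]
    exact smul_zero (A := Coeff q) (c M)
  · intro h
    exact absurd (relPos_mem_boundedMatrices V V') h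

lemma indicator_mul_apply (P P' : ∀ q : OddPrimePower, StepFlag n d q.K → StepFlag n d q.K → Prop)
    (q : OddPrimePower) (V V' : StepFlag n d q.K) :
    (indicator P * indicator P') q V V' =
      (Nat.card {V'' // P q V V'' ∧ P' q V'' V'} : Coeff q) := by
  classical
  rw [Pi.mul_apply, Matrix.mul_apply, Nat.card_eq_fintype_card, Fintype.card_subtype]
  simp only [indicator, mul_ite, mul_one, mul_zero, ← ite_and]
  rw [Finset.sum_boole]
  simp only [and_comm]

instance (q : OddPrimePower) : Nontrivial (Coeff q) :=
  inferInstanceAs (Nontrivial (LaurentPolynomial ℝ))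

instance (q : OddPrimePower) : CharZero (Coeff q) :=
  charZero_of_injective_ringHom (R := ℝ) (f := (LaurentPolynomial.C : ℝ →+* LaurentPolynomial ℝ))
    (RingHom.injective _)

/-- If the product of `indicator P` with an orbit function in `T` involves the orbit `M`, and all
other orbits involved in it belong to `T`, then so does `M`. -/
lemma orbitFun_mem_of_mul {T : Subalgebra LaurentRing (Families n d)} (hT : IsSaturated T)
    {P : ∀ q : OddPrimePower, StepFlag n d q.K → StepFlag n d q.K → Prop}
    (hP : indicator P ∈ T) (hP' : indicator P ∈ invariantFunctions n d)
    {A : Matrix (Fin n) (Fin n) ℕ} (hA : orbitFun n d A ∈ T)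
    (q₀ : OddPrimePower) {W W' W'' : StepFlag n d q₀.K} (hW : P q₀ W W'')
    (hWA : W''.relPos W' = A)
    (h : ∀ (q : OddPrimePower) (V V' V'' : StepFlag n d q.K), P q V V'' → V''.relPos V' = A →
      V.relPos V' ≠ W.relPos W' → orbitFun n d (V.relPos V') ∈ T) :
    orbitFun n d (W.relPos W') ∈ T := by
  classical
  have hg := T.mul_mem hP hA
  obtain ⟨-, c, hc⟩ := mul_mem_invariantFunctions hP' (orbitFun_mem_invariantFunctions (d := d) A)
  -- At `q₀` this coefficient specialises to a number of intermediate flags, which is positive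
  -- because `W''` is one of them.
  have hcW : c (W.relPos W') ≠ 0 := by
    intro h0
    have h1 := hc q₀ W W'
    rw [h0, map_zero, orbitFun, indicator_mul_apply, Nat.cast_eq_zero] at h1
    have : Nonempty {V'' // P q₀ W V'' ∧ V''.relPos W' = A} := ⟨⟨W'', hW, hWA⟩⟩
    exact Nat.card_pos.ne' h1
  rw [eq_sum_orbitFun hc, ← Finset.add_sum_erase _ _ (a := W.relPos W')
    (relPos_mem_boundedMatrices W W')] at hg
  refine hT _ hcW _ (orbitFun_mem_invariantFunctions _) ((T.toSubmodule.add_mem_iff_left ?_).1 hg)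
  refine Subalgebra.sum_mem _ fun N hN => ?_
  have hN := Finset.ne_of_mem_erase hN
  by_cases hex : ∃ (q : OddPrimePower) (V V' V'' : StepFlag n d q.K), P q V V'' ∧
      V''.relPos V' = A ∧ V.relPos V' = N
  · obtain ⟨q, V, V', V'', h1, h2, rfl⟩ := hex
    exact T.smul_mem (h q V V' V'' h1 h2 hN) _
  -- An orbit that the product never reaches may have a nonzero `c N` as a Laurent polynomial. Its
  -- specialisation still vanishes at every pair in that orbit, being an empty count.
  · have : c N • orbitFun n d N = 0 := by
      funext q V V'
      rw [Pi.smul_apply, Matrix.smul_apply, orbitFun, indicator]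
      split_ifs with hV
      · have h1 := hc q V V'
        have : IsEmpty {V'' // P q V V'' ∧ V''.relPos V' = A} :=
          ⟨fun V'' => hex ⟨q, V, V', V'', V''.2.1, V''.2.2, hV⟩⟩
        rw [orbitFun, indicator_mul_apply, Nat.card_of_isEmpty, Nat.cast_zero, hV] at h1
        rw [Algebra.smul_def, mul_one, ← h1]
        rfl
      · exact smul_zero (A := Coeff q) (c N)
    rw [this]
    exact T.zero_mem

/-- The sum of the entries of a matrix, weighted by the squared distance from the diagonal. -/
def offDiagWeight (M : Matrix (Fin n) (Fin n) ℕ) : ℤ :=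
  ∑ i : Fin n, ∑ j : Fin n, (M i j : ℤ) * ((i : ℤ) - j) ^ 2

lemma offDiagWeight_nonneg (M : Matrix (Fin n) (Fin n) ℕ) : 0 ≤ offDiagWeight M :=
  Finset.sum_nonneg fun _ _ => Finset.sum_nonneg fun _ _ => by positivity

lemma offDiagWeight_add_single (M : Matrix (Fin n) (Fin n) ℕ) (i j : Fin n) :
    offDiagWeight (M + Matrix.single i j 1) = offDiagWeight M + ((i : ℤ) - j) ^ 2 := by
  simp only [offDiagWeight, Matrix.add_apply, Nat.cast_add, add_mul, Finset.sum_add_distrib]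
  congr 1
  rw [Finset.sum_eq_single i, Finset.sum_eq_single j]
  · simp
  · intro b _ hb
    rw [Matrix.single_apply_of_col_ne _ _ hb.symm]
    simp
  · simp
  · intro a _ ha
    refine Finset.sum_eq_zero fun b _ => ?_
    rw [Matrix.single_apply_of_row_ne ha.symm]
    simp
  · simp

/-- Every other orbit in the product arises from `A` by undoing the move in a column `p' ≠ p`.
Undoing it in column `p` would restore the original weight, and `hmax` says that any other available
column restores strictly less. -/
lemma orbitFun_mem_of_move {T : Subalgebra LaurentRing (Families n d)} (hT : IsSaturated T)
    {P : ∀ q : OddPrimePower, StepFlag n d q.K → StepFlag n d q.K → Prop}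
    (hP : indicator P ∈ T) (hP' : indicator P ∈ invariantFunctions n d) {h h' p : Fin n}
    (hmove : ∀ (q : OddPrimePower) (V V' V'' : StepFlag n d q.K), P q V V'' →
      ∃ p', V.relPos V' + Matrix.single h' p' 1 = V''.relPos V' + Matrix.single h p' 1)
    {q₀ : OddPrimePower} {W W' W'' : StepFlag n d q₀.K} (hW : P q₀ W W'')
    (hWA : W.relPos W' + Matrix.single h' p 1 = W''.relPos W' + Matrix.single h p 1)
    (ih : ∀ N, offDiagWeight N < offDiagWeight (W.relPos W') → orbitFun n d N ∈ T)
    (hp : ((h' : ℤ) - p) ^ 2 < ((h : ℤ) - p) ^ 2)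
    (hmax : ∀ p' : Fin n, p' ≠ p → W.relPos W' h' p' ≠ 0 →
      ((h : ℤ) - p') ^ 2 - ((h' : ℤ) - p') ^ 2 < ((h : ℤ) - p) ^ 2 - ((h' : ℤ) - p) ^ 2) :
    orbitFun n d (W.relPos W') ∈ T := by
  have hne : h ≠ h' := by
    rintro rfl
    exact lt_irrefl _ hp
  have hweight := congrArg offDiagWeight hWA
  rw [offDiagWeight_add_single, offDiagWeight_add_single] at hweight
  refine orbitFun_mem_of_mul hT hP hP' (ih _ (by linarith)) q₀ hW rfl
    fun q V V' V'' hV hA hVW => ih _ ?_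
  obtain ⟨p', hp'⟩ := hmove q V V' V'' hV
  rw [hA] at hp'
  have hpp : p' ≠ p := by
    rintro rfl
    exact hVW (add_right_cancel (hp'.trans hWA.symm))
  -- Undoing the move in column `p'` takes a unit from the entry `(h', p')` of `A`. This entry
  -- agrees with that of the original matrix because `p' ≠ p`, so `hmax` applies.
  have h1 := congrFun₂ hp' h' p'
  have h2 := congrFun₂ hWA h' p'
  rw [Matrix.add_apply, Matrix.add_apply, Matrix.single_apply_same,
    Matrix.single_apply_of_row_ne hne] at h1
  rw [Matrix.add_apply, Matrix.add_apply, Matrix.single_apply_of_row_ne hne,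
    Matrix.single_apply_of_col_ne _ _ hpp.symm] at h2
  have h3 := hmax p' hpp (by omega)
  have h4 := congrArg offDiagWeight hp'
  rw [offDiagWeight_add_single, offDiagWeight_add_single] at h4
  linarith

lemma orbitFun_diagonal (r : Fin n → ℕ) :
    orbitFun n d (Matrix.diagonal r) = diagHom n d (Pi.single r 1) := by
  funext q V V'
  rw [orbitFun, indicator, diagHom_apply, relPos_eq_diagonal_iff, Pi.single_apply]
  by_cases h1 : V = V'
  · by_cases h2 : V.layer = r
    · rw [if_pos ⟨h1, h2⟩, if_pos h1, if_pos h2, map_one]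
    · rw [if_neg fun h => h2 h.2, if_pos h1, if_neg h2, map_zero]
  · rw [if_neg fun h => h1 h.1, if_neg h1]

theorem orbitFun_mem {T : Subalgebra LaurentRing (Families n d)} (hT : IsSaturated T)
    (hdiag : ∀ c, diagHom n d c ∈ T) (hraise : ∀ a : Fin n, (a : ℕ) + 1 < n → raise a ∈ T)
    (hlower : ∀ a : Fin n, (a : ℕ) + 1 < n → lower a ∈ T) (M : Matrix (Fin n) (Fin n) ℕ) :
    orbitFun n d M ∈ T := by
  classical
  induction hk : (offDiagWeight M).toNat using Nat.strong_induction_on generalizing M with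
  | _ k ih =>
  by_cases hM : ∃ (q : OddPrimePower) (V V' : StepFlag n d q.K), V.relPos V' = M
  swap
  · push Not at hM
    rw [orbitFun_eq_zero hM]
    exact T.zero_mem
  obtain ⟨q, W, W', rfl⟩ := hM
  have ih : ∀ N, offDiagWeight N < offDiagWeight (W.relPos W') → orbitFun n d N ∈ T := by
    intro N hN
    have := offDiagWeight_nonneg N
    exact ih _ (by omega) N rfl
  by_cases hup : ∃ p h : Fin n, h < p ∧ W.relPos W' h p ≠ 0
  -- Take the rightmost column with an entry above the diagonal. Undoing the move from row `h + 1`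
  -- to row `h` in column `p'` restores weight `2 (p' - h) - 1`, which increases with `p'`. A
  -- competitor `p' > p` would be a nonzero entry above the diagonal further to the right.
  · obtain ⟨p, ⟨h, hhp, hne⟩, hmax⟩ := WellFounded.has_min (wellFounded_gt (α := Fin n))
      {p | ∃ h : Fin n, h < p ∧ W.relPos W' h p ≠ 0} hup
    have hhp' : (h : ℕ) < p := hhp
    have hlt : (h : ℕ) + 1 < n := by omega
    let h' : Fin n := ⟨h + 1, hlt⟩
    have hh' : ((h' : ℕ) : ℤ) = h + 1 := by simp [h']
    obtain ⟨W'', hcov, hWA⟩ := exists_coversAt_lower (h' := h') rfl hne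
    refine orbitFun_mem_of_move hT (hraise h hlt) (raise_mem_invariantFunctions h)
      (fun q V V' V'' hV => hV.exists_relPos rfl V') hcov hWA ih ?_ fun p' hp' hne' => ?_
    · rw [hh']
      have : (h : ℤ) + 1 ≤ p := by exact_mod_cast hhp'
      nlinarith
    · have h1 : ¬ p' > p := fun hgt => hmax p' ⟨h', lt_of_le_of_lt hhp' hgt, hne'⟩ hgt
      have h2 : ((p' : ℕ) : ℤ) < p := by
        exact_mod_cast lt_of_le_of_ne (not_lt.1 h1) hp'
      rw [hh']
      nlinarith
  by_cases hlow : ∃ p h : Fin n, p < h ∧ W.relPos W' h p ≠ 0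
  -- Below the diagonal the situation is mirrored: the leftmost column restores the most weight.
  · obtain ⟨p, ⟨h, hhp, hne⟩, hmin⟩ := WellFounded.has_min (wellFounded_lt (α := Fin n))
      {p | ∃ h : Fin n, p < h ∧ W.relPos W' h p ≠ 0} hlow
    have hhp' : (p : ℕ) < h := hhp
    let h' : Fin n := ⟨h - 1, by omega⟩
    have hh : (h : ℕ) = h' + 1 := by
      simp only [h']
      omega
    have hh' : ((h : ℕ) : ℤ) = (h' : ℕ) + 1 := by exact_mod_cast hh
    obtain ⟨W'', hcov, hWA⟩ := exists_coversAt_upper hh hne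
    refine orbitFun_mem_of_move hT (hlower h' (by omega)) (lower_mem_invariantFunctions h')
      (fun q V V' V'' hV => ?_) hcov hWA ih ?_ fun p' hp' hne' => ?_
    · obtain ⟨p', hp'⟩ := CoversAt.exists_relPos hh hV V'
      exact ⟨p', hp'.symm⟩
    · have : (p : ℤ) + 1 ≤ h := by exact_mod_cast hhp'
      rw [hh'] at this ⊢
      nlinarith
    · have h1 : ¬ p' < p := fun hgt => hmin p' ⟨h', by
        rw [Fin.lt_def] at hgt ⊢
        omega, hne'⟩ hgt
      have h2 : ((p : ℕ) : ℤ) < p' := by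
        exact_mod_cast lt_of_le_of_ne (not_lt.1 h1) (Ne.symm hp')
      rw [hh']
      nlinarith
  · push Not at hup hlow
    have hD : W.relPos W' = Matrix.diagonal fun i => W.relPos W' i i := by
      ext i j
      rcases lt_trichotomy i j with hij | rfl | hij
      · rw [hup j i hij, Matrix.diagonal_apply_ne _ hij.ne]
      · rw [Matrix.diagonal_apply_eq]
      · rw [hlow j i hij, Matrix.diagonal_apply_ne _ hij.ne']
    rw [hD, orbitFun_diagonal]
    exact hdiag _

theorem invariantFunctions_le {T : Subalgebra LaurentRing (Families n d)} (hT : IsSaturated T)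
    {ε : ℤˣ} (hgen : generators n d ε ⊆ T) : invariantFunctions n d ≤ T.toSubmodule := by
  have hdiag : ∀ c, diagHom n d c ∈ T :=
    diagHom_mem hT fun a => hgen (Or.inr (Or.inr (Or.inl ⟨1, a, rfl⟩)))
  have horb := orbitFun_mem hT hdiag
    (fun a ha => by
      have := hgen (Or.inl ⟨a, ha, rfl⟩)
      rw [genE_eq] at this
      exact mem_of_mul_diagHom_mono_mem hdiag _ _ this)
    (fun a ha => by
      have := hgen (Or.inr (Or.inl ⟨a, ha, rfl⟩))
      rw [genF_eq] at this
      exact mem_of_mul_diagHom_mono_mem hdiag _ _ this)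
  rintro f ⟨-, c, hc⟩
  rw [eq_sum_orbitFun hc]
  exact Subalgebra.sum_mem _ fun M _ => T.smul_mem (horb M) _

/-! ### Generation over `ℚ(v, t)` -/

theorem adjoin_generators (n d : ℕ) (ε : ℤˣ) :
    Algebra.adjoin RatField {x : RatField ⊗[LaurentRing] schurAlgebra n d |
      ∃ f : schurAlgebra n d, (f : Families n d) ∈ generators n d ε ∧
        x = 1 ⊗ₜ[LaurentRing] f} = ⊤ := by
  set B := Algebra.adjoin RatField {x : RatField ⊗[LaurentRing] schurAlgebra n d |
      ∃ f : schurAlgebra n d, (f : Families n d) ∈ generators n d ε ∧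
        x = 1 ⊗ₜ[LaurentRing] f} with hB
  have hmem : ∀ f : Families n d, f ∈ schurAlgebra n d ↔ f ∈ invariantFunctions n d := fun f => by
    rw [← toSubmodule_schurAlgebra, Subalgebra.mem_toSubmodule]
  -- `T` consists of the elements `f` of the algebra with `1 ⊗ f` in `B`. It is saturated because
  -- nonzero elements of the Laurent ring become invertible in `ℚ(v, t)`.
  let T : Subalgebra LaurentRing (Families n d) :=
    ((B.restrictScalars LaurentRing).comap (Algebra.TensorProduct.includeRight :
      schurAlgebra n d →ₐ[LaurentRing] RatField ⊗[LaurentRing] schurAlgebra n d)).map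
      (schurAlgebra n d).val
  have hTmem : ∀ f : schurAlgebra n d, (f : Families n d) ∈ T ↔
      (1 : RatField) ⊗ₜ[LaurentRing] f ∈ B := by
    intro f
    constructor
    · rintro ⟨g, hg, hgf⟩
      rwa [← Subtype.ext hgf]
    · intro h
      exact ⟨f, h, rfl⟩
  have hT : IsSaturated T := by
    intro a ha f hf haf
    lift f to schurAlgebra n d using (hmem f).2 hf
    rw [hTmem]
    have h1 : (1 : RatField) ⊗ₜ[LaurentRing] (a • f) ∈ B := (hTmem (a • f)).1 haf
    have h2 : algebraMap LaurentRing RatField a ≠ 0 := by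
      simpa using ha
    have h3 := B.smul_mem h1 (algebraMap LaurentRing RatField a)⁻¹
    rwa [TensorProduct.tmul_smul, ← algebraMap_smul RatField a, smul_smul, inv_mul_cancel₀ h2,
      one_smul] at h3
  have hgen : generators n d ε ⊆ T := by
    intro f hf
    lift f to schurAlgebra n d using (hmem f).2 (generators_subset ε hf)
    exact (hTmem f).2 (Algebra.subset_adjoin ⟨f, hf, rfl⟩)
  rw [eq_top_iff]
  rintro x -
  induction x with
  | zero => exact B.zero_mem
  | add x y hx hy => exact B.add_mem hx hy
  | tmul r f =>
    have h1 := (hTmem f).1 (invariantFunctions_le hT hgen ((hmem f).1 f.2))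
    have h2 := B.smul_mem h1 r
    rwa [TensorProduct.smul_tmul', smul_eq_mul, mul_one] at h2

end TwoParamSchur
end

theorem mainTheorem7 (n d : ℕ) (hn : 0 < n) (hd : 0 < d) :
    Subalgebra.toSubmodule (TwoParamSchur.schurAlgebra n d) =
        TwoParamSchur.invariantFunctions n d ∧
      ∀ ε : ℤˣ,
        TwoParamSchur.generators n d ε ⊆ TwoParamSchur.schurAlgebra n d ∧
        Algebra.adjoin TwoParamSchur.RatField
          {x : TwoParamSchur.RatField ⊗[TwoParamSchur.LaurentRing]
              TwoParamSchur.schurAlgebra n d |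
            ∃ f : TwoParamSchur.schurAlgebra n d,
              (f : TwoParamSchur.Families n d) ∈ TwoParamSchur.generators n d ε ∧
                x = 1 ⊗ₜ[TwoParamSchur.LaurentRing] f} = ⊤ :=
  ⟨TwoParamSchur.toSubmodule_schurAlgebra n d, fun ε =>
    ⟨(TwoParamSchur.generators_subset ε).trans Algebra.subset_adjoin,
      TwoParamSchur.adjoin_generators n d ε⟩⟩
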